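/- Let $D\subset\mathbf{R}^2$ be the closed unit disk centered at the origin, with boundary circle $\partial D$ oriented counterclockwise; for $p,q\in\partial D$ let $pq\subset\partial D$ denote the oriented arc with initial point $p$ and final point $q$. Let $f\colon D\to\mathbf{R}^2$ be an immersion, i.e., a continuous map which is locally one-to-one on $D$. Suppose that $f$ has polygonal boundary: there are finitely many points $v_i$, $i\in\mathbf{Z}_k$, cyclically arranged along $\partial D$ such that $f$ maps each arc $v_iv_{i+1}$ onto the line segment joining $f(v_i)$ to $f(v_{i+1})$. Call the second coordinate of a point of $\mathbf{R}^2$ its height. A simple (i.e., continuous and one-to-one) curve segment in $\mathbf{R}^2$ whose end points have different heights is called *weakly monotone* if attaching to its higher end point the vertical ray which extends upward, and to its lower end point the vertical ray which extends downward, yields a simple unbounded curve. Suppose that there are points $p_0,p_1\in\partial D$ such that the curves obtained by restricting $f$ to the arc $p_0p_1$ and to the arc $p_1p_0$ are both weakly monotone (in particular, $f$ is one-to-one on each of these two arcs). Then $f$ is one-to-one on $D$. -/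

import Mathlib

open Set

/-- The Euclidean plane. -/
abbrev Plane : Type := EuclideanSpace ℝ (Fin 2)

/-- The closed unit disk centered at the origin, as a topological space. -/
abbrev ClosedDisk : Type := Metric.closedBall (0 : Plane) 1

/-- The boundary circle of the disk. -/
def diskBoundary : Set ClosedDisk := {x | ‖(x : Plane)‖ = 1}

/-- The point of the boundary circle at angle `t`; the circle is oriented by increasing `t`. -/
noncomputable def circlePoint (t : ℝ) : ClosedDisk :=
  ⟨!₂[Real.cos t, Real.sin t], by
    simp [EuclideanSpace.norm_eq, Fin.sum_univ_two]⟩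

/-- An immersion is a continuous locally one-to-one map. -/
def IsTopImmersion {X Y : Type*} [TopologicalSpace X] [TopologicalSpace Y] (f : X → Y) : Prop :=
  Continuous f ∧ IsLocallyInjective f

/-- There are finitely many points, cyclically arranged along the boundary circle (at the angles
`θ 0 < θ 1 < ⋯ < θ k = θ 0 + 2π`), such that `f` maps each arc between consecutive points onto the
line segment joining the images of its end points. -/
def HasPolygonalBoundary (f : ClosedDisk → Plane) : Prop :=
  ∃ (k : ℕ) (θ : Fin (k + 1) → ℝ), StrictMono θ ∧ θ (Fin.last k) = θ 0 + 2 * Real.pi ∧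
    ∀ i : Fin k, (fun t => f (circlePoint t)) '' Icc (θ i.castSucc) (θ i.succ) =
      segment ℝ (f (circlePoint (θ i.castSucc))) (f (circlePoint (θ i.succ)))

/-- The height of a point of the plane. -/
def planeHeight (x : Plane) : ℝ := x 1

/-- The curve `γ` on `[a, b]`, extended to the whole line by vertical rays attached to its end
points: the ray at the higher end point goes up, the ray at the lower end point goes down. -/
noncomputable def verticalExtension (γ : ℝ → Plane) (a b : ℝ) (t : ℝ) : Plane :=
  let σ : ℝ := if planeHeight (γ a) < planeHeight (γ b) then 1 else -1
  if t < a then γ a + (σ * (t - a)) • !₂[(0 : ℝ), 1]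
  else if t ≤ b then γ t
  else γ b + (σ * (t - b)) • !₂[(0 : ℝ), 1]

/-- The curve `γ` on `[a, b]` is a weakly monotone simple curve segment. -/
structure IsWeaklyMonotone (γ : ℝ → Plane) (a b : ℝ) : Prop where
  le : a ≤ b
  continuousOn : ContinuousOn γ (Icc a b)
  injOn : InjOn γ (Icc a b)
  height_ne : planeHeight (γ a) ≠ planeHeight (γ b)
  /-- the extended curve is simple -/
  injective_extension : Function.Injective (verticalExtension γ a b)

/-- The image under `f` of the positively oriented arc of the boundary circle with initial point `p`
and final point `q` is weakly monotone. -/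
def IsWeaklyMonotoneArc (f : ClosedDisk → Plane) (p q : ClosedDisk) : Prop :=
  ∃ a b : ℝ, a ≤ b ∧ b < a + 2 * Real.pi ∧ circlePoint a = p ∧ circlePoint b = q ∧
    IsWeaklyMonotone (fun t => f (circlePoint t)) a b

/-! ### Winding numbers of closed curves through continuous logarithms. -/

section Winding

open Filter Topology Metric

/-! Exchange the coordinates so that height becomes the real part, attach the vertical rays to both
boundary arcs, and traverse the second arc backwards. The result is two simple lines `Γ₀` and `Γ₁`
with the same ends, both running from the far left to the far right (`BoundaryLines`). Seen from a
point `q` off such a line, the direction to the moving point turns by `π` or `-π` altogether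
(`RightwardLine.hasTurning_or`). The turning is constant on connected sets off the line, and beside
a straight piece it is computed by Hopf's argument with secants
(`RightwardLine.eventually_hasTurning_left`).

The common rays cancel in the difference of the two lines, so the boundary curve of the disk has
winding number `(turning of Γ₀ - turning of Γ₁) / 2π` around `q`
(`BoundaryLines.turning_sub_turning`), which is `-1`, `0` or `1`. On the other hand, local
injectivity gives the map one nonzero local degree `d` throughout the disk, and the winding number
is `d` times the number of preimages of `q` (`exists_degree`). Hence a point off both lines has at
most one preimage, and if it has one, its turning with respect to `Γ₁` is forced to be `-d * π`
(`BoundaryLines.exists_turning`).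

Coincidences `F x = F y` whose common value lies on a line remain. If `y` is interior, the map is
open at `y`, and moving `x` slightly produces a value off the lines with two preimages
(`BoundaryLines.apply_ne_of_mem_ball`). If `y` lies on the second arc but not on the first, `Γ₁`
cuts a small ball around `F y` into two sides of different turning. Nearby values taken near `x` and
near `y` have the same turning, hence lie on the same side, and that side is filled by values taken
near `y`; again some value has two preimages (`BoundaryLines.apply_ne_of_mem_sphere`). Two points of
the first arc are separated because `Γ₀` is simple. -/

theorem exists_continuous_log {E : Type*} [NormedAddCommGroup E] [NormedSpace ℝ E] {g : E → ℂ}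
    (hg : Continuous g) (h0 : ∀ x, g x ≠ 0) :
    ∃ L : E → ℂ, Continuous L ∧ ∀ x, Complex.exp (L x) = g x := by
  obtain ⟨F, ⟨-, hF⟩, -⟩ := Complex.isCoveringMapOn_exp.existsUnique_continuousMap_lifts
    ⟨g, hg⟩ (a₀ := 0) (e₀ := Complex.log (g 0)) (Complex.exp_log (h0 0)) (fun x => h0 x)
  exact ⟨F, F.continuous, fun x => congrFun hF x⟩

/-- Uniqueness of lifts through the covering `exp`: two logarithms of one function on a connected
set differ by a constant. All later comparisons of angles are instances of this. -/
theorem IsPreconnected.sub_eq_of_exp_eq {X : Type*} [TopologicalSpace X] {S : Set X}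
    (hS : IsPreconnected S) {A B : X → ℂ} (hA : ContinuousOn A S) (hB : ContinuousOn B S)
    (h : ∀ x ∈ S, Complex.exp (A x) = Complex.exp (B x)) {x y : X} (hx : x ∈ S) (hy : y ∈ S) :
    A x - B x = A y - B y := by
  have h1 : S.EqOn A (fun z => B z + (A x - B x)) := by
    have hlift : S.EqOn ((fun z : ℂ ↦ (⟨_, z.exp_ne_zero⟩ : {z : ℂ // z ≠ 0})) ∘ A)
        ((fun z : ℂ ↦ (⟨_, z.exp_ne_zero⟩ : {z : ℂ // z ≠ 0})) ∘
          (fun z => B z + (A x - B x))) := by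
      intro z hz
      apply Subtype.ext
      simp only [Function.comp]
      rw [Complex.exp_add, Complex.exp_sub, h x hx, h z hz, div_self (Complex.exp_ne_zero _),
        mul_one]
    exact Complex.isCoveringMap_exp.eqOn_of_comp_eqOn hS hA (hB.add continuousOn_const) hlift hx
      (by ring)
  have := h1 hy
  simp only at this
  rw [this]; ring

/-- The closed curve `φ` of period `2π` has winding number `n` around the origin. -/
def HasWinding (φ : ℝ → ℂ) (n : ℤ) : Prop :=
  ∃ L : ℝ → ℂ, Continuous L ∧ (∀ t, Complex.exp (L t) = φ t) ∧
    ∀ t, L (t + 2 * Real.pi) = L t + n * (2 * Real.pi * Complex.I)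

theorem two_pi_I_mul_inj {m n : ℤ}
    (h : (m : ℂ) * (2 * Real.pi * Complex.I) = n * (2 * Real.pi * Complex.I)) : m = n := by
  have := mul_right_cancel₀ Complex.two_pi_I_ne_zero h
  exact_mod_cast this

theorem HasWinding.eq_of_lift {φ : ℝ → ℂ} {n : ℤ} (h : HasWinding φ n) {L : ℝ → ℂ}
    (hL : Continuous L) (hφ : ∀ t, Complex.exp (L t) = φ t) (t : ℝ) :
    L (t + 2 * Real.pi) = L t + n * (2 * Real.pi * Complex.I) := by
  obtain ⟨M, hM, hMφ, hMn⟩ := h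
  have := isPreconnected_univ.sub_eq_of_exp_eq hL.continuousOn hM.continuousOn
    (fun x _ => by rw [hφ, hMφ]) (mem_univ (t + 2 * Real.pi)) (mem_univ t)
  rw [hMn] at this
  linear_combination this

theorem HasWinding.unique {φ : ℝ → ℂ} {m n : ℤ} (hm : HasWinding φ m) (hn : HasWinding φ n) :
    m = n := by
  obtain ⟨L, hL, hφ, hLm⟩ := hm
  have h1 := hn.eq_of_lift hL hφ 0
  rw [hLm 0] at h1
  exact two_pi_I_mul_inj (add_left_cancel h1)

theorem exists_hasWinding {φ : ℝ → ℂ} (hφ : Continuous φ) (h0 : ∀ t, φ t ≠ 0)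
    (hper : ∀ t, φ (t + 2 * Real.pi) = φ t) : ∃ n, HasWinding φ n := by
  obtain ⟨L, hL, hLφ⟩ := exists_continuous_log hφ h0
  have h1 : Complex.exp (L (0 + 2 * Real.pi)) = Complex.exp (L 0) := by rw [hLφ, hLφ, hper]
  obtain ⟨n, hn⟩ := Complex.exp_eq_exp_iff_exists_int.1 h1
  refine ⟨n, L, hL, hLφ, fun t => ?_⟩
  have := isPreconnected_univ.sub_eq_of_exp_eq (A := fun t => L (t + 2 * Real.pi)) (B := L)
    (by fun_prop) hL.continuousOn (fun x _ => by rw [hLφ, hLφ, hper]) (mem_univ t) (mem_univ 0)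
  rw [hn] at this
  linear_combination this

theorem HasWinding.mul {φ ψ : ℝ → ℂ} {m n : ℤ} (hφ : HasWinding φ m) (hψ : HasWinding ψ n) :
    HasWinding (fun t => φ t * ψ t) (m + n) := by
  obtain ⟨L, hL, hLφ, hLm⟩ := hφ
  obtain ⟨M, hM, hMψ, hMn⟩ := hψ
  refine ⟨fun t => L t + M t, by fun_prop, fun t => by rw [Complex.exp_add, hLφ, hMψ],
    fun t => ?_⟩
  simp only [hLm, hMn]; push_cast; ring

theorem HasWinding.zpow {φ : ℝ → ℂ} {n : ℤ} (hφ : HasWinding φ n) (k : ℤ) :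
    HasWinding (fun t => φ t ^ k) (k * n) := by
  obtain ⟨L, hL, hLφ, hLn⟩ := hφ
  refine ⟨fun t => k * L t, by fun_prop, fun t => by rw [Complex.exp_int_mul, hLφ],
    fun t => ?_⟩
  simp only [hLn]; push_cast; ring

theorem hasWinding_const {c : ℂ} (hc : c ≠ 0) : HasWinding (fun _ => c) 0 :=
  ⟨fun _ => Complex.log c, continuous_const, fun _ => Complex.exp_log hc, fun _ => by simp⟩

/-- Homotopy invariance of the winding number. -/
theorem HasWinding.homotopy {H : ℝ → ℝ → ℂ} (hH : Continuous (Function.uncurry H))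
    (h0 : ∀ s ∈ Icc (0 : ℝ) 1, ∀ t, H s t ≠ 0) (hper : ∀ s t, H s (t + 2 * Real.pi) = H s t)
    {n : ℤ} (hn : HasWinding (H 0) n) : HasWinding (H 1) n := by
  have hcl : ∀ s : ℝ, max 0 (min s 1) ∈ Icc (0 : ℝ) 1 := fun s => by simp
  obtain ⟨L, hL, hLH⟩ := exists_continuous_log (E := ℝ × ℝ)
    (g := fun p => H (max 0 (min p.1 1)) p.2)
    (hH.comp (f := fun p : ℝ × ℝ => (max 0 (min p.1 1), p.2)) (by fun_prop))
    (fun p => h0 _ (hcl _) _)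
  have h1 : ∀ t, L (0, t + 2 * Real.pi) = L (0, t) + n * (2 * Real.pi * Complex.I) :=
    hn.eq_of_lift (L := fun t => L (0, t)) (by fun_prop) (fun t => by simp [hLH])
  refine ⟨fun t => L (1, t), by fun_prop, fun t => by simp [hLH], fun t => ?_⟩
  have := isPreconnected_univ.sub_eq_of_exp_eq (A := fun p : ℝ × ℝ => L (p.1, p.2 + 2 * Real.pi))
    (B := L) (by fun_prop) hL.continuousOn (fun x _ => by rw [hLH, hLH, hper])
    (mem_univ (1, t)) (mem_univ (0, t))
  simp only [h1] at this
  linear_combination this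

theorem circleMap_add_two_pi (c : ℂ) (r t : ℝ) :
    circleMap c r (t + 2 * Real.pi) = circleMap c r t :=
  periodic_circleMap c r t

theorem continuous_circleMap_uncurry {X : Type*} [TopologicalSpace X] {c : X → ℂ} {r t : X → ℝ}
    (hc : Continuous c) (hr : Continuous r) (ht : Continuous t) :
    Continuous fun x => circleMap (c x) (r x) (t x) := by
  unfold circleMap; fun_prop

theorem hasWinding_zero_of_closedBall {g : ℂ → ℂ} (hg : Continuous g) {c : ℂ} {r : ℝ} (hr : 0 ≤ r)
    (h0 : ∀ z ∈ closedBall c r, g z ≠ 0) : HasWinding (fun t => g (circleMap c r t)) 0 := by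
  have := HasWinding.homotopy (H := fun s t => g (circleMap c (s * r) t)) (n := 0)
    (hg.comp (continuous_circleMap_uncurry continuous_const (by fun_prop) (by fun_prop)))
    (fun s hs t => h0 _ ?_) (fun s t => by rw [circleMap_add_two_pi]) ?_
  · simpa using this
  · rw [mem_closedBall, dist_eq_norm, circleMap_sub_center, norm_circleMap_zero, abs_of_nonneg
      (mul_nonneg hs.1 hr)]
    exact mul_le_of_le_one_left hr hs.2
  · simpa using hasWinding_const (h0 c (mem_closedBall_self hr))

/-- A logarithm of `φ` advances by an odd multiple of `π * I` over half a period, and by the same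
amount over the next half. -/
theorem HasWinding.odd {φ : ℝ → ℂ} (hodd : ∀ t, φ (t + Real.pi) = -φ t) {n : ℤ}
    (h : HasWinding φ n) : Odd n := by
  obtain ⟨L, hL, hφ, hLn⟩ := h
  have h1 : Complex.exp (L (0 + Real.pi)) = Complex.exp (L 0 + Real.pi * Complex.I) := by
    rw [Complex.exp_add, Complex.exp_pi_mul_I, hφ, hφ, hodd]; ring
  obtain ⟨k, hk⟩ := Complex.exp_eq_exp_iff_exists_int.1 h1
  have h2 := isPreconnected_univ.sub_eq_of_exp_eq (A := fun t => L (t + Real.pi))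
    (B := fun t => L t + Real.pi * Complex.I)
    (by fun_prop) (by fun_prop) (fun x _ => by
      rw [Complex.exp_add, Complex.exp_pi_mul_I, hφ, hφ, hodd]; ring)
    (mem_univ 0) (mem_univ (0 + Real.pi))
  have h3 := hLn 0
  rw [hk, show (0 : ℝ) + Real.pi + Real.pi = 0 + 2 * Real.pi by ring, h3] at h2
  refine ⟨k, two_pi_I_mul_inj ?_⟩
  push_cast
  linear_combination -h2

theorem hasWinding_circleMap_sub_center (c : ℂ) {r : ℝ} (hr : 0 < r) :
    HasWinding (fun t => circleMap c r t - c) 1 := by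
  refine ⟨fun t => Complex.log r + t * Complex.I, by fun_prop, fun t => ?_, fun t => ?_⟩
  · rw [Complex.exp_add, Complex.exp_log (by exact_mod_cast hr.ne')]
    simp [circleMap]
  · push_cast; ring

theorem hasWinding_circleMap_sub {c w : ℂ} {r : ℝ} (hw : w ∈ ball c r) :
    HasWinding (fun t => circleMap c r t - w) 1 := by
  have hr : 0 < r := dist_nonneg.trans_lt hw
  have := HasWinding.homotopy (H := fun s t => circleMap c r t - (c + s * (w - c))) (n := 1)
    ((continuous_circleMap_uncurry continuous_const (by fun_prop) (by fun_prop)).sub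
      (by fun_prop))
    (fun s hs t h => ?_) (fun s t => by simp only [circleMap_add_two_pi]) ?_
  · simpa using this
  · have h1 : circleMap c r t - c = s * (w - c) := by linear_combination h
    have h2 := congrArg norm h1
    rw [circleMap_sub_center, norm_circleMap_zero, norm_mul, Complex.norm_real, ← dist_eq_norm,
      abs_of_pos hr, Real.norm_of_nonneg hs.1] at h2
    have : s * dist w c ≤ dist w c := mul_le_of_le_one_left dist_nonneg hs.2
    rw [mem_ball] at hw
    linarith
  · simpa using hasWinding_circleMap_sub_center c hr

/-- Winding number zero makes the logarithm periodic, so it descends to the circle, and Tietze's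
theorem extends it to the plane. Its exponential then fills the circle without zeros. -/
theorem exists_continuous_extension_log {g : ℂ → ℂ} {c : ℂ} {r : ℝ} (hr : 0 < r)
    (h : HasWinding (fun t => g (circleMap c r t)) 0) :
    ∃ l : ℂ → ℂ, Continuous l ∧ ∀ z ∈ sphere c r, Complex.exp (l z) = g z := by
  obtain ⟨L, hL, hLg, hper⟩ := h
  have hper' : Function.Periodic L (2 * Real.pi) := fun t => by simpa using hper t
  let M : Real.Angle → ℂ := hper'.lift
  have hM : Continuous M := continuous_coinduced_dom.2 hL
  have hcont : Continuous fun z : sphere c r => M ((z - c : ℂ).arg : Real.Angle) := by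
    refine hM.comp (continuous_iff_continuousAt.2 fun z => ?_)
    have hz : (z - c : ℂ) ≠ 0 := sub_ne_zero.2 (ne_of_mem_sphere z.2 hr.ne')
    exact (Complex.continuousAt_arg_coe_angle hz).comp (f := fun z : sphere c r => (z - c : ℂ))
      (by fun_prop)
  obtain ⟨l, hl⟩ := ContinuousMap.exists_restrict_eq isClosed_sphere ⟨_, hcont⟩
  refine ⟨l, l.continuous, fun z hz => ?_⟩
  have h1 : l z = L (z - c).arg := congrArg (fun φ => φ ⟨z, hz⟩) hl
  rw [h1, hLg]
  rw [mem_sphere, dist_eq_norm] at hz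
  simp only [circleMap, ← hz, Complex.norm_mul_exp_arg_mul_I]; ring_nf

/-- A winding number is the sum of the local winding numbers at the enclosed zeros. -/
theorem hasWinding_sum (d : ℂ → ℤ) (Z : Finset ℂ) : ∀ {g : ℂ → ℂ}, Continuous g →
    (∀ z ∈ Z, z ∈ ball (0 : ℂ) 1) → (∀ z ∈ closedBall (0 : ℂ) 1, g z = 0 → z ∈ Z) →
    (∀ z ∈ Z, ∀ᶠ r in 𝓝[>] (0 : ℝ), HasWinding (fun t => g (circleMap z r t)) (d z)) →
    HasWinding (fun t => g (circleMap 0 1 t)) (∑ z ∈ Z, d z) := by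
  induction Z using Finset.induction_on with
  | empty =>
    intro g hg _ h0 _
    simpa using hasWinding_zero_of_closedBall hg zero_le_one
      (fun z hz h => absurd (h0 z hz h) (by simp))
  | insert c Z hc ih =>
    intro g hg hball h0 hd
    have hcball : c ∈ ball (0 : ℂ) 1 := hball c (by simp)
    obtain ⟨r, hr, hrball, hrZ, hrd⟩ : ∃ r > 0, closedBall c r ⊆ ball (0 : ℂ) 1 ∧
        (∀ z ∈ Z, r < dist z c) ∧ HasWinding (fun t => g (circleMap c r t)) (d c) := by
      have h1 : ∀ᶠ r in 𝓝[>] (0 : ℝ), closedBall c r ⊆ ball (0 : ℂ) 1 := by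
        have : ∀ᶠ r in 𝓝 (0 : ℝ), r < 1 - dist c 0 := by
          apply eventually_lt_nhds; rw [mem_ball] at hcball; linarith
        filter_upwards [nhdsWithin_le_nhds this] with r hr
        exact closedBall_subset_ball' (by linarith)
      have h2 : ∀ᶠ r in 𝓝[>] (0 : ℝ), ∀ z ∈ Z, r < dist z c := by
        rw [Filter.eventually_all_finset]
        intro z hz
        exact nhdsWithin_le_nhds (eventually_lt_nhds (dist_pos.2 fun h => hc (h ▸ hz)))
      obtain ⟨r, ⟨⟨h1, h2⟩, h3⟩, h4⟩ :=
        (((h1.and h2).and (hd c (by simp))).and self_mem_nhdsWithin).exists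
      exact ⟨r, h4, h1, h2, h3⟩
    -- Dividing by `(z - c) ^ d c` removes the winding on the small circle around `c`. Inside that
    -- circle `k` can then be replaced by a function without zeros, so that `c` disappears from the
    -- set of zeros.
    let k : ℂ → ℂ := fun z => g z * (z - c) ^ (-d c)
    have hk : ContinuousOn k {c}ᶜ := hg.continuousOn.mul
      (ContinuousOn.zpow₀ (by fun_prop) _ fun z hz => Or.inl (sub_ne_zero.2 hz))
    have hk0 : HasWinding (fun t => k (circleMap c r t)) 0 := by
      have := hrd.mul ((hasWinding_circleMap_sub_center c hr).zpow (-d c))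
      rwa [mul_one, add_neg_cancel] at this
    obtain ⟨l, hl, hlk⟩ := exists_continuous_extension_log hr hk0
    let g' : ℂ → ℂ := fun z => if r ≤ dist z c then k z else Complex.exp (l z)
    have hg'k : ∀ z, r ≤ dist z c → g' z = k z := fun z hz => if_pos hz
    have hg' : Continuous g' := by
      apply continuous_if
      · intro z hz
        refine (hlk z ?_).symm
        exact (frontier_le_subset_eq continuous_const (by fun_prop) hz).symm
      · refine hk.mono ?_
        rw [(isClosed_le continuous_const (by fun_prop)).closure_eq]
        rintro z hz rfl
        simp only [mem_ofPred_eq, dist_self] at hz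
        linarith
      · fun_prop
    have hcirc : ∀ t, r ≤ dist (circleMap 0 1 t) c := by
      intro t
      by_contra h
      have := hrball (ball_subset_closedBall (not_le.1 h))
      simp at this
    have hW := ih hg' (fun z hz => hball z (by simp [hz])) (fun z hz hz0 => ?_) (fun z hz => ?_)
    · have := hW.mul ((hasWinding_circleMap_sub hcball).zpow (d c))
      rw [Finset.sum_insert hc, add_comm]
      rw [mul_one] at this
      convert! this using 2 with t
      rw [hg'k _ (hcirc t)]
      have hne : circleMap 0 1 t - c ≠ 0 :=
        sub_ne_zero.2 (dist_pos.1 (hr.trans_le (hcirc t)))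
      simp only [k]
      rw [mul_assoc, ← zpow_add₀ hne]; simp
    · by_cases h : r ≤ dist z c
      · rw [hg'k z h] at hz0
        rcases mul_eq_zero.1 hz0 with h1 | h1
        · exact (Finset.mem_insert.1 (h0 z hz h1)).resolve_left
            fun h2 => by rw [h2, dist_self] at h; linarith
        · exact absurd h1 (zpow_ne_zero _ (sub_ne_zero.2 (dist_pos.1 (hr.trans_le h))))
      · simp only [g', if_neg h] at hz0
        exact absurd hz0 (Complex.exp_ne_zero _)
    · have h1 : ∀ᶠ s in 𝓝[>] (0 : ℝ), s < dist z c - r :=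
        nhdsWithin_le_nhds (eventually_lt_nhds (by linarith [hrZ z hz]))
      filter_upwards [hd z (by simp [hz]), h1, self_mem_nhdsWithin] with s hs hs1 hs0
      have h2 : ∀ w ∈ closedBall z s, r ≤ dist w c := fun w hw => by
        have := dist_triangle z w c
        rw [mem_closedBall, dist_comm] at hw
        linarith
      -- A small circle around another zero does not enclose `c`, so the extra factor leaves the
      -- local winding number there unchanged.
      have h3 : HasWinding (fun t => circleMap z s t - c) 0 :=
        hasWinding_zero_of_closedBall (g := fun w => w - c) (by fun_prop) hs0.le
          fun w hw => sub_ne_zero.2 (dist_pos.1 (hr.trans_le (h2 w hw)))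
      have h4 := hs.mul (h3.zpow (-d c))
      rw [mul_zero, add_zero] at h4
      convert! h4 using 2 with t
      rw [hg'k _ (h2 _ (circleMap_mem_closedBall z (le_of_lt hs0) t))]

end Winding

/-! ### The local degree of a locally injective map and the count of preimages. -/

section LocalDegree

open Filter Topology Metric

variable {F : ℂ → ℂ} {ε : ℝ}

/-- As in Borsuk's theorem, `F w - F 0` on a small circle deforms through `F w - F (-s * w)` to the
odd function `F w - F (-w)`, so `d` is odd and hence nonzero. Moving centre and radius linearly
carries this circle to any other admissible one without creating a zero. -/
theorem exists_local_degree (hF : Continuous F) (hε : 0 < ε)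
    (hinj : ∀ x ∈ closedBall (0 : ℂ) 1, ∀ y ∈ closedBall (0 : ℂ) 1, x ≠ y → dist x y < ε →
      F x ≠ F y) :
    ∃ d : ℤ, d ≠ 0 ∧ ∀ x : ℂ, ∀ r : ℝ, 0 < r → r < ε → r ≤ 1 - ‖x‖ →
      HasWinding (fun t => F (circleMap x r t) - F x) d := by
  -- The diameter, not just the radius, must stay below `ε`, because antipodal points are compared.
  obtain ⟨r₀, hr₀, hr₀ε, hr₀1⟩ : ∃ r₀ : ℝ, 0 < r₀ ∧ 2 * r₀ < ε ∧ r₀ ≤ 1 :=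
    ⟨min (ε / 3) 1, by positivity, by linarith [min_le_left (ε / 3) 1], min_le_right _ _⟩
  have hnorm : ∀ t, ‖circleMap 0 r₀ t‖ = r₀ := fun t => by
    rw [norm_circleMap_zero, abs_of_pos hr₀]
  obtain ⟨d, hd⟩ := exists_hasWinding (φ := fun t => F (circleMap 0 r₀ t) - F 0)
    (by have := continuous_circleMap 0 r₀; fun_prop)
    (fun t => sub_ne_zero.2 (hinj _ (by simp [hnorm, hr₀1]) _ (by simp)
      (by rw [← norm_pos_iff, hnorm]; exact hr₀)
      (by rw [dist_zero_right, hnorm]; linarith)))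
    (fun t => by simp only [circleMap_add_two_pi])
  refine ⟨d, ?_, fun x r hr hrε hr1 => ?_⟩
  · have h1 := HasWinding.homotopy
      (H := fun s t => F (circleMap 0 r₀ t) - F (-(s * circleMap 0 r₀ t))) (n := d)
      (by
        have : Continuous fun p : ℝ × ℝ => circleMap 0 r₀ p.2 :=
          continuous_circleMap_uncurry continuous_const (by fun_prop) (by fun_prop)
        unfold Function.uncurry; fun_prop)
      (fun s hs t => sub_ne_zero.2 (hinj _ (by simp [hnorm, hr₀1]) _ ?_ ?_ ?_))
      (fun s t => by simp only [circleMap_add_two_pi]) (by simpa using hd)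
    · have h2 : Odd d := HasWinding.odd (fun t => ?_) h1
      · rintro rfl; simp at h2
      · have h3 : circleMap 0 r₀ (t + Real.pi) = -circleMap 0 r₀ t := by
          simp [circleMap, add_mul, Complex.exp_add]
        simp only [h3]; push_cast; ring_nf
    · simp only [mem_closedBall, dist_zero_right, norm_neg, norm_mul, hnorm, Complex.norm_real,
        Real.norm_of_nonneg hs.1]
      nlinarith [hs.1, hs.2]
    · intro h
      have h2 : (1 + s : ℂ) * circleMap 0 r₀ t = 0 := by linear_combination h
      have h3 := congrArg norm h2
      rw [norm_mul, hnorm, norm_zero, show (1 + s : ℂ) = ((1 + s : ℝ) : ℂ) by push_cast; rfl,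
        Complex.norm_real, Real.norm_of_nonneg (by linarith [hs.1])] at h3
      nlinarith [hs.1]
    · rw [dist_eq_norm, show circleMap 0 r₀ t - -(s * circleMap 0 r₀ t) =
        ((1 + s : ℝ) : ℂ) * circleMap 0 r₀ t by push_cast; ring, norm_mul, hnorm,
        Complex.norm_real, Real.norm_of_nonneg (by linarith [hs.1])]
      nlinarith [hs.2]
  · have h1 := HasWinding.homotopy
      (H := fun s t => F (circleMap (s * x) (r₀ + s * (r - r₀)) t) - F (s * x)) (n := d)
      (by
        have : Continuous fun p : ℝ × ℝ => circleMap (p.1 * x) (r₀ + p.1 * (r - r₀)) p.2 :=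
          continuous_circleMap_uncurry (by fun_prop) (by fun_prop) (by fun_prop)
        unfold Function.uncurry; fun_prop)
      (fun s hs t => ?_) (fun s t => by simp only [circleMap_add_two_pi]) (by simpa using hd)
    · simpa using h1
    · have hpos : 0 < r₀ + s * (r - r₀) := by
        rcases eq_or_lt_of_le hs.1 with h | h
        · rw [← h]; simpa
        · nlinarith [hs.2, mul_pos h hr]
      have hnx : ‖(s * x : ℂ)‖ = s * ‖x‖ := by
        rw [norm_mul, Complex.norm_real, Real.norm_of_nonneg hs.1]
      have hdist : dist (circleMap (s * x) (r₀ + s * (r - r₀)) t) (s * x) =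
          r₀ + s * (r - r₀) := by
        rw [dist_eq_norm, circleMap_sub_center, norm_circleMap_zero, abs_of_pos hpos]
      refine sub_ne_zero.2 (hinj _ ?_ _ ?_ ?_ ?_)
      · rw [mem_closedBall]
        refine (dist_triangle _ (s * x : ℂ) 0).trans ?_
        rw [hdist, dist_zero_right, hnx]
        nlinarith [hs.1, hs.2]
      · rw [mem_closedBall, dist_zero_right, hnx]
        nlinarith [hs.1, hs.2, norm_nonneg x]
      · rw [← dist_pos, hdist]; exact hpos
      · rw [hdist]; nlinarith [hs.1, hs.2]

/-- Invariance of domain by degree. For `q` closer to `F x` than the image of a small circle around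
`x`, the winding number around `q` is still `d ≠ 0`; if `q` were not a value on the enclosed disk,
shrinking the circle would make it zero. -/
theorem image_mem_nhds_of_mem_ball (hF : Continuous F) (hε : 0 < ε)
    (hinj : ∀ x ∈ closedBall (0 : ℂ) 1, ∀ y ∈ closedBall (0 : ℂ) 1, x ≠ y → dist x y < ε →
      F x ≠ F y) {x : ℂ} (hx : x ∈ ball (0 : ℂ) 1) {U : Set ℂ} (hU : U ∈ 𝓝 x) :
    F '' U ∈ 𝓝 (F x) := by
  obtain ⟨d, hd0, hd⟩ := exists_local_degree hF hε hinj
  rw [mem_ball, dist_zero_right] at hx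
  obtain ⟨R, hR, hRU⟩ := nhds_basis_closedBall.mem_iff.1 hU
  obtain ⟨r, hr, hrR, hrε, hr1⟩ : ∃ r : ℝ, 0 < r ∧ r ≤ R ∧ r < ε ∧ r ≤ 1 - ‖x‖ :=
    ⟨min R (min (ε / 2) (1 - ‖x‖)), by
      have : 0 < 1 - ‖x‖ := by linarith
      positivity, min_le_left _ _,
      ((min_le_right _ _).trans (min_le_left _ _)).trans_lt (by linarith),
      (min_le_right _ _).trans (min_le_right _ _)⟩
  have hW := hd x r hr hrε hr1
  obtain ⟨w, hw, hmin⟩ := (isCompact_sphere x r).exists_isMinOn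
    (NormedSpace.sphere_nonempty.2 hr.le) (f := fun w => dist (F w) (F x)) (by fun_prop)
  have hcm : ∀ t, circleMap x r t ∈ sphere x r := fun t => circleMap_mem_sphere x hr.le t
  have hδ : 0 < dist (F w) (F x) := by
    have hwx : dist w x = r := hw
    refine dist_pos.2 (hinj _ ?_ _ ?_ ?_ ?_)
    · rw [mem_closedBall]
      refine (dist_triangle w x 0).trans ?_
      rw [hwx, dist_zero_right]; linarith
    · rw [mem_closedBall, dist_zero_right]; exact hx.le
    · rw [← dist_pos, hwx]; exact hr
    · rwa [hwx]
  refine mem_of_superset (ball_mem_nhds _ hδ) fun q hq => ?_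
  by_contra hqU
  have h1 := HasWinding.homotopy
    (H := fun s t => F (circleMap x r t) - (F x + s * (q - F x))) (n := d)
    (by
      have : Continuous fun p : ℝ × ℝ => circleMap x r p.2 :=
        continuous_circleMap_uncurry (by fun_prop) (by fun_prop) (by fun_prop)
      unfold Function.uncurry; fun_prop)
    (fun s hs t h => ?_) (fun s t => by simp only [circleMap_add_two_pi]) (by simpa using hW)
  · have h2 := hasWinding_zero_of_closedBall (g := fun z => F z - q) (by fun_prop) hr.le
      (fun z hz h => hqU ⟨z, hRU (closedBall_subset_closedBall hrR hz), sub_eq_zero.1 h⟩)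
    exact hd0 (HasWinding.unique (by simpa using h1) h2)
  · have h2 : F (circleMap x r t) - F x = s * (q - F x) := by linear_combination h
    have h3 := congrArg norm h2
    have h4 : dist (F w) (F x) ≤ dist (F (circleMap x r t)) (F x) := hmin (hcm t)
    rw [norm_mul, Complex.norm_real, Real.norm_of_nonneg hs.1, ← dist_eq_norm,
      ← dist_eq_norm] at h3
    rw [mem_ball] at hq
    nlinarith [hs.1, hs.2, dist_nonneg (x := q) (y := F x)]

/-- For a map which is locally injective on the closed unit disk, the winding number of the
boundary curve around a point is a fixed nonzero multiple of the number of its preimages. -/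
theorem exists_degree (hF : Continuous F) (hε : 0 < ε)
    (hinj : ∀ x ∈ closedBall (0 : ℂ) 1, ∀ y ∈ closedBall (0 : ℂ) 1, x ≠ y → dist x y < ε →
      F x ≠ F y) :
    ∃ d : ℤ, d ≠ 0 ∧ ∀ q, (∀ z ∈ sphere (0 : ℂ) 1, F z ≠ q) →
      ∃ Z : Finset ℂ, (∀ z, z ∈ Z ↔ z ∈ closedBall (0 : ℂ) 1 ∧ F z = q) ∧
        HasWinding (fun t => F (circleMap 0 1 t) - q) (Z.card * d) := by
  obtain ⟨d, hd0, hd⟩ := exists_local_degree hF hε hinj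
  refine ⟨d, hd0, fun q hq => ?_⟩
  have hfin : (closedBall (0 : ℂ) 1 ∩ F ⁻¹' {q}).Finite := by
    refine IsCompact.finite ((isCompact_closedBall 0 1).inter_right
      (isClosed_singleton.preimage hF)) ?_
    rw [isDiscrete_iff_forall_mem_exists_isOpen]
    rintro x ⟨hx, hxq⟩
    refine ⟨ball x ε, isOpen_ball, ?_⟩
    ext y
    constructor
    · rintro ⟨hy, hyD, hyq⟩
      by_contra hne
      exact hinj y hyD x hx hne hy (hyq.trans hxq.symm)
    · rintro rfl
      exact ⟨mem_ball_self hε, hx, hxq⟩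
  have hmem : ∀ z, z ∈ hfin.toFinset ↔ z ∈ closedBall (0 : ℂ) 1 ∧ F z = q := by simp
  refine ⟨hfin.toFinset, hmem, ?_⟩
  have hball : ∀ z ∈ hfin.toFinset, z ∈ ball (0 : ℂ) 1 := fun z hz => by
    rw [hmem] at hz
    refine lt_of_le_of_ne hz.1 fun h => hq z h hz.2
  have := hasWinding_sum (fun _ => d) hfin.toFinset (g := fun z => F z - q) (by fun_prop) hball
    (fun z hz h => (hmem z).2 ⟨hz, sub_eq_zero.1 h⟩) (fun z hz => ?_)
  · simpa using this
  · have h1 := hball z hz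
    rw [mem_ball, dist_zero_right] at h1
    filter_upwards [self_mem_nhdsWithin, nhdsWithin_le_nhds (eventually_lt_nhds hε),
      nhdsWithin_le_nhds (eventually_lt_nhds (show 0 < 1 - ‖z‖ by linarith))] with r h2 h3 h4
    rw [← ((hmem z).1 hz).2]
    exact hd z r h2 h3 h4.le

end LocalDegree

/-! ### Simple lines with horizontal ends, and their turning around a point. -/

section Line

open Filter Topology Metric

/-- A simple curve which runs along horizontal rays, to the right, near both of its ends, and
starts in a straight way from each of its points in both directions. -/
structure RightwardLine (Γ : ℝ → ℂ) : Prop where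
  continuous : Continuous Γ
  injective : Function.Injective Γ
  right_ray : ∃ (R : ℝ) (P : ℂ), ∀ t ≥ R, Γ t = P + t
  left_ray : ∃ (R : ℝ) (P : ℂ), ∀ t ≤ R, Γ t = P + t
  cone_right : ∀ s, ∃ ε > 0, ∃ e : ℂ, ∀ t ∈ Icc s (s + ε), ∃ r : ℝ, 0 ≤ r ∧ Γ t = Γ s + r * e
  cone_left : ∀ s, ∃ ε > 0, ∃ e : ℂ, ∀ t ∈ Icc (s - ε) s, ∃ r : ℝ, 0 ≤ r ∧ Γ t = Γ s + r * e

/-- The direction from `q` to the moving point `Γ t` turns by `σ` altogether. -/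
def HasTurning (Γ : ℝ → ℂ) (q : ℂ) (σ : ℝ) : Prop :=
  ∃ A : ℝ → ℂ, Continuous A ∧ (∀ t, Complex.exp (A t) = Γ t - q) ∧
    Tendsto (fun p : ℝ × ℝ => (A p.1).im - (A p.2).im) (atTop ×ˢ atBot) (𝓝 σ)

variable {Γ : ℝ → ℂ}

theorem HasTurning.tendsto_of_lift {q : ℂ} {σ : ℝ} (h : HasTurning Γ q σ) {A : ℝ → ℂ}
    (hA : Continuous A) (hAΓ : ∀ t, Complex.exp (A t) = Γ t - q) :
    Tendsto (fun p : ℝ × ℝ => (A p.1).im - (A p.2).im) (atTop ×ˢ atBot) (𝓝 σ) := by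
  obtain ⟨B, hB, hBΓ, hlim⟩ := h
  refine hlim.congr fun p => ?_
  have := isPreconnected_univ.sub_eq_of_exp_eq hA.continuousOn hB.continuousOn
    (fun x _ => by rw [hAΓ, hBΓ]) (mem_univ p.1) (mem_univ p.2)
  have h2 := congrArg Complex.im this
  simp only [Complex.sub_im] at h2
  linarith

theorem HasTurning.unique {q : ℂ} {σ τ : ℝ} (h : HasTurning Γ q σ) (h' : HasTurning Γ q τ) :
    σ = τ := by
  obtain ⟨A, hA, hAΓ, hlim⟩ := h
  exact tendsto_nhds_unique hlim (h'.tendsto_of_lift hA hAΓ)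

theorem tendsto_arg_add_ofReal (c : ℂ) :
    Tendsto (fun t : ℝ => (c + t).arg) atTop (𝓝 0) := by
  have h1 : Tendsto (fun t : ℝ => 1 + c * ((t⁻¹ : ℝ) : ℂ)) atTop (𝓝 (1 + c * ((0 : ℝ) : ℂ))) :=
    tendsto_const_nhds.add (tendsto_const_nhds.mul
      ((Complex.continuous_ofReal.tendsto 0).comp tendsto_inv_atTop_zero))
  rw [Complex.ofReal_zero, mul_zero, add_zero] at h1
  have h2 := (Complex.continuousAt_arg Complex.one_mem_slitPlane).tendsto.comp h1
  rw [Complex.arg_one] at h2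
  refine h2.congr' ?_
  filter_upwards [eventually_gt_atTop 0] with t ht
  have h3 : c + t = (t : ℂ) * (1 + c * ((t⁻¹ : ℝ) : ℂ)) := by
    have : (t : ℂ) ≠ 0 := by exact_mod_cast ht.ne'
    push_cast; field_simp; ring
  rw [h3, Complex.arg_real_mul _ ht]; rfl

/-- Moving the viewpoint multiplies `Γ t - q` by a factor `1 + c / (Γ t - q)`. The angle of this
factor dies out at the ends, so it does not affect the total turning. -/
theorem tendsto_log_ratio {l : Filter ℝ} {q : ℂ} (hl : Tendsto (fun t => ‖Γ t - q‖) l atTop)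
    (c : ℂ) : Tendsto (fun t => (Complex.log (1 + c / (Γ t - q))).im) l (𝓝 0) := by
  have h1 : Tendsto (fun t => c / (Γ t - q)) l (𝓝 0) := by
    rw [tendsto_zero_iff_norm_tendsto_zero]
    simp only [norm_div]
    exact tendsto_const_nhds.div_atTop hl
  have h2 : Tendsto (fun t => 1 + c / (Γ t - q)) l (𝓝 1) := by
    simpa using h1.const_add 1
  have h3 := (Complex.continuousAt_arg Complex.one_mem_slitPlane).tendsto.comp h2
  rw [Complex.arg_one] at h3
  simpa only [Complex.log_im, Function.comp_def] using h3

namespace RightwardLine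

/-- The half turn about the origin, with time reversed, exchanges the two ends, so statements at
`-∞` follow from those at `+∞`. -/
theorem reverse (h : RightwardLine Γ) : RightwardLine fun t => -Γ (-t) where
  continuous := by have := h.continuous; fun_prop
  injective := fun a b hab => neg_injective (h.injective (neg_injective hab))
  right_ray := by
    obtain ⟨R, P, hP⟩ := h.left_ray
    refine ⟨-R, -P, fun t ht => ?_⟩
    rw [hP _ (by linarith)]; push_cast; ring
  left_ray := by
    obtain ⟨R, P, hP⟩ := h.right_ray
    refine ⟨-R, -P, fun t ht => ?_⟩
    rw [hP _ (by linarith)]; push_cast; ring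
  cone_right := fun s => by
    obtain ⟨ε, hε, e, he⟩ := h.cone_left (-s)
    refine ⟨ε, hε, -e, fun t ht => ?_⟩
    obtain ⟨r, hr, h1⟩ := he (-t) ⟨by linarith [ht.2], by linarith [ht.1]⟩
    exact ⟨r, hr, by rw [h1]; ring⟩
  cone_left := fun s => by
    obtain ⟨ε, hε, e, he⟩ := h.cone_right (-s)
    refine ⟨ε, hε, -e, fun t ht => ?_⟩
    obtain ⟨r, hr, h1⟩ := he (-t) ⟨by linarith [ht.2], by linarith [ht.1]⟩
    exact ⟨r, hr, by rw [h1]; ring⟩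

/-- Reflection exchanges the two sides of the line and negates its turning. -/
theorem conj (h : RightwardLine Γ) : RightwardLine fun t => starRingEnd ℂ (Γ t) where
  continuous := Complex.continuous_conj.comp h.continuous
  injective := (starRingEnd ℂ).injective.comp h.injective
  right_ray := by
    obtain ⟨R, P, hP⟩ := h.right_ray
    exact ⟨R, starRingEnd ℂ P, fun t ht => by rw [hP _ ht]; simp⟩
  left_ray := by
    obtain ⟨R, P, hP⟩ := h.left_ray
    exact ⟨R, starRingEnd ℂ P, fun t ht => by rw [hP _ ht]; simp⟩
  cone_right := fun s => by
    obtain ⟨ε, hε, e, he⟩ := h.cone_right s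
    refine ⟨ε, hε, starRingEnd ℂ e, fun t ht => ?_⟩
    obtain ⟨r, hr, h1⟩ := he t ht
    exact ⟨r, hr, by rw [h1]; simp⟩
  cone_left := fun s => by
    obtain ⟨ε, hε, e, he⟩ := h.cone_left s
    refine ⟨ε, hε, starRingEnd ℂ e, fun t ht => ?_⟩
    obtain ⟨r, hr, h1⟩ := he t ht
    exact ⟨r, hr, by rw [h1]; simp⟩

end RightwardLine

theorem HasTurning.of_conj {q : ℂ} {σ : ℝ}
    (h : HasTurning (fun t => starRingEnd ℂ (Γ t)) (starRingEnd ℂ q) σ) :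
    HasTurning Γ q (-σ) := by
  obtain ⟨A, hA, hAΓ, hlim⟩ := h
  refine ⟨fun t => starRingEnd ℂ (A t), Complex.continuous_conj.comp hA, fun t => ?_, ?_⟩
  · rw [Complex.exp_conj, hAΓ]; simp
  · refine hlim.neg.congr fun p => ?_
    simp only [Complex.conj_im]; ring

namespace RightwardLine

variable (h : RightwardLine Γ)
include h

theorem tendsto_norm_sub_atTop (q : ℂ) : Tendsto (fun t => ‖Γ t - q‖) atTop atTop := by
  obtain ⟨R, P, hP⟩ := h.right_ray
  refine tendsto_atTop_mono' _ ?_ (tendsto_atTop_add_const_right atTop (-‖P - q‖) tendsto_id)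
  filter_upwards [eventually_ge_atTop R] with t ht
  rw [hP t ht]
  have h1 := norm_sub_norm_le (t : ℂ) (-(P - q))
  rw [norm_neg, Complex.norm_real, show (t : ℂ) - -(P - q) = P + t - q by ring] at h1
  have := le_abs_self t
  rw [Real.norm_eq_abs] at h1
  simp only [id]; linarith

theorem tendsto_norm_sub_atBot (q : ℂ) : Tendsto (fun t => ‖Γ t - q‖) atBot atTop := by
  have := (h.reverse.tendsto_norm_sub_atTop (-q)).comp tendsto_neg_atBot_atTop
  refine this.congr fun t => ?_
  simp only [Function.comp, neg_neg]
  rw [← norm_neg]; congr 1; ring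

theorem isClosedMap : IsClosedMap Γ := by
  refine (isProperMap_iff_tendsto_cocompact.2 ⟨h.continuous, ?_⟩).isClosedMap
  rw [Metric.cobounded_eq_cocompact.symm, Metric.cobounded_eq_cocompact.symm]
  rw [← tendsto_norm_atTop_iff_cobounded, Metric.cobounded_eq_cocompact,
    cocompact_eq_atBot_atTop, tendsto_sup]
  exact ⟨by simpa using h.tendsto_norm_sub_atBot 0, by simpa using h.tendsto_norm_sub_atTop 0⟩

theorem isClosed_range : IsClosed (range Γ) := h.isClosedMap.isClosed_range

theorem exists_dist_ge (s : ℝ) {ε : ℝ} (hε : 0 < ε) :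
    ∃ m > 0, ∀ t, ε ≤ |t - s| → m ≤ dist (Γ t) (Γ s) := by
  have hcl : IsClosed (Γ '' {t | ε ≤ |t - s|}) :=
    h.isClosedMap _ (isClosed_le continuous_const (by fun_prop))
  have hs : Γ s ∈ (Γ '' {t | ε ≤ |t - s|})ᶜ := by
    rintro ⟨t, ht, hts⟩
    rw [h.injective hts] at ht
    simp only [mem_ofPred_eq, sub_self, abs_zero] at ht
    linarith
  obtain ⟨m, hm, hms⟩ := Metric.isOpen_iff.1 hcl.isOpen_compl _ hs
  exact ⟨m, hm, fun t ht => not_lt.1 fun hlt => hms hlt ⟨t, ht, rfl⟩⟩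

theorem hasTurning_of_dist_lt {q q' : ℂ} {σ : ℝ} (hσ : HasTurning Γ q σ)
    (hd : ∀ t, dist q q' < dist (Γ t) q) : HasTurning Γ q' σ := by
  obtain ⟨A, hA, hAΓ, hlim⟩ := hσ
  have hne : ∀ t, Γ t - q ≠ 0 := fun t => by rw [← hAΓ]; exact Complex.exp_ne_zero _
  have hlt : ∀ t, ‖(q - q') / (Γ t - q)‖ < 1 := fun t => by
    rw [norm_div, div_lt_one (norm_pos_iff.2 (hne t)), ← dist_eq_norm, ← dist_eq_norm]
    exact hd t
  have hsl := fun t => Complex.mem_slitPlane_of_norm_lt_one (hlt t)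
  refine ⟨fun t => A t + Complex.log (1 + (q - q') / (Γ t - q)), ?_, fun t => ?_, ?_⟩
  · refine hA.add (Continuous.clog ?_ hsl)
    exact continuous_const.add (continuous_const.div (h.continuous.sub continuous_const) hne)
  · rw [Complex.exp_add, hAΓ, Complex.exp_log (Complex.slitPlane_ne_zero (hsl t))]
    have := hne t
    field_simp; ring
  · have h1 := (tendsto_log_ratio (h.tendsto_norm_sub_atTop q) (q - q')).comp
      (tendsto_fst (f := (atTop : Filter ℝ)) (g := (atBot : Filter ℝ)))
    have h2 := (tendsto_log_ratio (h.tendsto_norm_sub_atBot q) (q - q')).comp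
      (tendsto_snd (f := (atTop : Filter ℝ)) (g := (atBot : Filter ℝ)))
    have h3 := hlim.add (h1.sub h2)
    rw [sub_zero, add_zero] at h3
    refine h3.congr fun p => ?_
    simp only [Function.comp, Complex.add_im]; ring

theorem hasTurning_of_isPreconnected {C : Set ℂ} (hC : IsPreconnected C)
    (hCΓ : Disjoint C (range Γ)) {q : ℂ} (hq : q ∈ C) {σ : ℝ} (hσ : HasTurning Γ q σ) :
    ∀ q' ∈ C, HasTurning Γ q' σ := by
  have hcl := h.isClosed_range
  have hball : ∀ w ∉ range Γ, ∃ r > 0, ∀ t, r ≤ dist (Γ t) w := fun w hw => by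
    obtain ⟨r, hr, hrw⟩ := Metric.isOpen_iff.1 hcl.isOpen_compl w hw
    exact ⟨r, hr, fun t => not_lt.1 fun hlt => hrw hlt (mem_range_self t)⟩
  let U : Set ℂ := {w | w ∉ range Γ ∧ HasTurning Γ w σ}
  have hU : IsOpen U := by
    rw [Metric.isOpen_iff]
    rintro w ⟨hw, hwσ⟩
    obtain ⟨r, hr, hrw⟩ := hball w hw
    refine ⟨r, hr, fun w' hw' => ⟨?_, h.hasTurning_of_dist_lt hwσ fun t => ?_⟩⟩
    · rintro ⟨t, rfl⟩
      exact absurd hw' (not_lt.2 (hrw t))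
    · rw [dist_comm]; exact hw'.trans_le (hrw t)
  have hsub : C ⊆ U := by
    refine hC.subset_of_closure_inter_subset hU ⟨q, hq, disjoint_left.1 hCΓ hq, hσ⟩ ?_
    rintro w ⟨hwU, hwC⟩
    have hw := disjoint_left.1 hCΓ hwC
    refine ⟨hw, ?_⟩
    obtain ⟨r, hr, hrw⟩ := hball w hw
    obtain ⟨w', ⟨-, hw'σ⟩, hd⟩ := Metric.mem_closure_iff.1 hwU (r / 2) (by positivity)
    refine h.hasTurning_of_dist_lt hw'σ fun t => ?_
    have h1 := hrw t
    have h2 := dist_triangle (Γ t) w' w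
    rw [dist_comm] at hd
    linarith
  exact fun q' hq' => (hsub hq').2

/-- Simplicity of the curve makes the secants nonzero on the open half plane `p.1 < p.2`. The
coordinates `(p.1, log (p.2 - p.1))` identify this half plane with `ℝ × ℝ`, where logarithms exist.
-/
theorem exists_secant_log : ∃ Θ : ℝ × ℝ → ℂ, ContinuousOn Θ {p | p.1 < p.2} ∧
    ∀ p : ℝ × ℝ, p.1 < p.2 → Complex.exp (Θ p) = Γ p.2 - Γ p.1 := by
  have hΓ := h.continuous
  obtain ⟨L, hL, hLΓ⟩ := exists_continuous_log (E := ℝ × ℝ)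
    (g := fun p => Γ (p.1 + Real.exp p.2) - Γ p.1) (by fun_prop)
    (fun p h0 => by
      have := h.injective (sub_eq_zero.1 h0)
      linarith [Real.exp_pos p.2])
  refine ⟨fun p => L (p.1, Real.log (p.2 - p.1)), ?_, fun p hp => ?_⟩
  · refine hL.comp_continuousOn (continuousOn_fst.prodMk (ContinuousOn.log (by fun_prop) ?_))
    intro p hp
    exact (sub_pos.2 hp).ne'
  · rw [hLΓ]
    simp only [Real.exp_log (sub_pos.2 hp)]
    congr 2; ring

theorem eventually_re_lt_atTop (s : ℝ) :
    ∀ᶠ T in atTop, ∀ t ≤ s, (Γ t).re < (Γ T).re := by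
  obtain ⟨M, hM⟩ : ∃ M, ∀ t ≤ s, (Γ t).re ≤ M := by
    obtain ⟨R, P, hP⟩ := h.left_ray
    have hc : ContinuousOn (fun t => (Γ t).re) (Icc R s) :=
      (Complex.continuous_re.comp h.continuous).continuousOn
    obtain ⟨M, hM⟩ := (isCompact_Icc.image_of_continuousOn hc).bddAbove
    refine ⟨max M (P.re + R), fun t ht => ?_⟩
    rcases le_total t R with htR | htR
    · rw [hP t htR]; exact le_max_of_le_right (by simpa)
    · exact le_max_of_le_left (hM ⟨t, ⟨htR, ht⟩, rfl⟩)
  obtain ⟨R, P, hP⟩ := h.right_ray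
  filter_upwards [eventually_ge_atTop R, eventually_gt_atTop (M - P.re)] with T hT hTM t ht
  have := hM t ht
  rw [hP T hT, Complex.add_re, Complex.ofReal_re]
  linarith

theorem eventually_re_lt_atBot (s : ℝ) :
    ∀ᶠ S in atBot, ∀ t ≥ s, (Γ S).re < (Γ t).re := by
  have := tendsto_neg_atBot_atTop.eventually (h.reverse.eventually_re_lt_atTop (-s))
  filter_upwards [this] with S hS t ht
  simpa using hS (-t) (by linarith)

/-- Hopf's trick. With `T = p.1` far right and `S = p.2` far left, go from `(s, T)` to `(S, T)` and
on to `(S, s)`. All secants on this path have positive real part, so `Θ` differs from the principal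
logarithm by one constant along it. -/
theorem eventually_secant_log_eq {Θ : ℝ × ℝ → ℂ} (hΘ : ContinuousOn Θ {p | p.1 < p.2})
    (hΘΓ : ∀ p : ℝ × ℝ, p.1 < p.2 → Complex.exp (Θ p) = Γ p.2 - Γ p.1) (s : ℝ) :
    ∀ᶠ p in atTop ×ˢ atBot, Θ (s, p.1) - Complex.log (Γ p.1 - Γ s) =
      Θ (p.2, s) - Complex.log (Γ s - Γ p.2) := by
  filter_upwards [((h.eventually_re_lt_atTop s).and (eventually_gt_atTop s)).prod_mk
    ((h.eventually_re_lt_atBot s).and (eventually_lt_atBot s))] with p hp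
  obtain ⟨⟨hT, hTs⟩, hS, hSs⟩ := hp
  generalize p.1 = T at *
  generalize p.2 = S at *
  have hpre : IsPreconnected (Icc S s ×ˢ {T} ∪ {S} ×ˢ Icc s T) := by
    refine IsPreconnected.union (S, T) ?_ ?_ (isPreconnected_Icc.prod isPreconnected_singleton)
      (isPreconnected_singleton.prod isPreconnected_Icc)
    · exact ⟨⟨le_rfl, hSs.le⟩, rfl⟩
    · exact ⟨rfl, ⟨hTs.le, le_rfl⟩⟩
  have hlt : ∀ x ∈ Icc S s ×ˢ {T} ∪ {S} ×ˢ Icc s T, x.1 < x.2 ∧ (Γ x.1).re < (Γ x.2).re := by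
    rintro ⟨a, b⟩ (⟨ha, hb⟩ | ⟨ha, hb⟩)
    · obtain rfl : b = T := hb
      exact ⟨ha.2.trans_lt hTs, hT a ha.2⟩
    · obtain rfl : a = S := ha
      exact ⟨hSs.trans_le hb.1, hS b hb.1⟩
  have hΓ := h.continuous
  refine hpre.sub_eq_of_exp_eq (A := Θ) (B := fun x => Complex.log (Γ x.2 - Γ x.1))
    (x := (s, T)) (y := (S, s)) (hΘ.mono fun x hx => (hlt x hx).1)
    (ContinuousOn.clog (by fun_prop) fun x hx => Or.inl ?_) (fun x hx => ?_) ?_ ?_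
  · simpa using (hlt x hx).2
  · have hx' := (hlt x hx).1
    rw [hΘΓ x hx', Complex.exp_log (sub_ne_zero.2 fun h0 => ?_)]
    exact hx'.ne' (h.injective h0)
  · exact Or.inl ⟨⟨hSs.le, le_rfl⟩, rfl⟩
  · exact Or.inr ⟨rfl, ⟨le_rfl, hTs.le⟩⟩

theorem tendsto_arg_atTop (s : ℝ) : Tendsto (fun T => (Γ T - Γ s).arg) atTop (𝓝 0) := by
  obtain ⟨R, P, hP⟩ := h.right_ray
  refine (tendsto_arg_add_ofReal (P - Γ s)).congr' ?_
  filter_upwards [eventually_ge_atTop R] with T hT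
  rw [hP T hT]; congr 1; ring

theorem tendsto_arg_atBot (s : ℝ) : Tendsto (fun S => (Γ s - Γ S).arg) atBot (𝓝 0) := by
  have := (h.reverse.tendsto_arg_atTop (-s)).comp tendsto_neg_atBot_atTop
  refine this.congr fun S => ?_
  simp only [Function.comp, neg_neg]; congr 1; ring

end RightwardLine

/-- The second number is the first one turned by `-I` and rescaled. The two signs of `ρ` each
contribute half of the final turning `π`. -/
theorem arg_add_mul_I_of_pos {δ ρ : ℝ} (hδ : 0 < δ) (hρ : 0 < ρ) :
    (δ + ρ * Complex.I : ℂ).arg - (1 - (δ / ρ : ℝ) * Complex.I : ℂ).arg = Real.pi / 2 := by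
  have h1 : (1 - (δ / ρ : ℝ) * Complex.I : ℂ) =
      ((ρ⁻¹ : ℝ) : ℂ) * ((δ + ρ * Complex.I : ℂ) * -Complex.I) := by
    have : (ρ : ℂ) ≠ 0 := by exact_mod_cast hρ.ne'
    push_cast; field_simp; linear_combination (ρ : ℂ) * Complex.I_sq
  have h0 : (δ + ρ * Complex.I : ℂ) ≠ 0 := fun h => hδ.ne' (by simpa using congrArg Complex.re h)
  have h2 : 0 ≤ (δ + ρ * Complex.I : ℂ).arg := Complex.arg_nonneg_iff.2 (by simp [hρ.le])
  have h3 := Complex.arg_le_pi (δ + ρ * Complex.I : ℂ)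
  rw [h1, Complex.arg_real_mul _ (by positivity), Complex.arg_mul h0 (by simp), Complex.arg_neg_I]
  · ring
  · rw [Complex.arg_neg_I]
    constructor <;> linarith [Real.pi_pos]

theorem arg_add_mul_I_of_neg {δ ρ : ℝ} (hδ : 0 < δ) (hρ : ρ < 0) :
    (δ + ρ * Complex.I : ℂ).arg - (1 - (δ / ρ : ℝ) * Complex.I : ℂ).arg = -(Real.pi / 2) := by
  have h1 : (1 - (δ / ρ : ℝ) * Complex.I : ℂ) =
      (((-ρ)⁻¹ : ℝ) : ℂ) * ((δ + ρ * Complex.I : ℂ) * Complex.I) := by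
    have : (ρ : ℂ) ≠ 0 := by exact_mod_cast hρ.ne
    push_cast; rw [inv_neg]; field_simp; linear_combination (ρ : ℂ) * Complex.I_sq
  have h0 : (δ + ρ * Complex.I : ℂ) ≠ 0 := fun h => hδ.ne' (by simpa using congrArg Complex.re h)
  have h2 : (δ + ρ * Complex.I : ℂ).arg < 0 := Complex.arg_neg_iff.2 (by simp [hρ])
  have h3 := Complex.neg_pi_lt_arg (δ + ρ * Complex.I : ℂ)
  rw [h1, Complex.arg_real_mul _ (inv_pos.2 (neg_pos.2 hρ)), Complex.arg_mul h0 (by simp),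
    Complex.arg_I]
  · ring
  · rw [Complex.arg_I]
    constructor <;> linarith [Real.pi_pos]

end Line

/-! ### The turning beside a straight piece of the line. -/

section Jump

open Filter Topology Metric

variable {Γ : ℝ → ℂ}

namespace RightwardLine

variable (h : RightwardLine Γ)
include h

/-- Points slightly to the left of a straight piece of the curve have turning `π`. This is Hopf's
argument: the secants of the curve form a simply connected family. -/
theorem eventually_hasTurning_left {s ε : ℝ} (hε : 0 < ε) {e : ℂ} (he : e ≠ 0) {ρ : ℝ → ℝ}
    (hρ : StrictMonoOn ρ (Icc (s - ε) (s + ε)))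
    (hΓρ : ∀ t ∈ Icc (s - ε) (s + ε), Γ t = Γ s + ρ t * e) :
    ∀ᶠ δ : ℝ in 𝓝[>] 0, HasTurning Γ (Γ s + δ * Complex.I * e) Real.pi := by
  obtain ⟨m, hm, hms⟩ := h.exists_dist_ge s hε
  obtain ⟨Θ, hΘ, hΘΓ⟩ := h.exists_secant_log
  have hΓ := h.continuous
  have hne : 0 < ‖e‖ := norm_pos_iff.2 he
  have hsm : s ∈ Icc (s - ε) (s + ε) := ⟨by linarith, by linarith⟩
  have hlm : s - ε ∈ Icc (s - ε) (s + ε) := ⟨by linarith, by linarith⟩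
  have hrm : s + ε ∈ Icc (s - ε) (s + ε) := ⟨by linarith, by linarith⟩
  have hρs : ρ s = 0 := by
    have h1 : (ρ s : ℂ) * e = 0 := by linear_combination -hΓρ s hsm
    exact_mod_cast (mul_eq_zero.1 h1).resolve_right he
  have hρr : 0 < ρ (s + ε) := hρs ▸ hρ hsm hrm (by linarith)
  have hρl : ρ (s - ε) < 0 := hρs ▸ hρ hlm hsm (by linarith)
  -- On the straight piece every secant is a positive multiple of `e`, so `Θ` has constant angle on
  -- this triangle of parameters.
  have hΘ0 : (Θ (s, s + ε)).im = (Θ (s - ε, s)).im := by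
    have hS : Convex ℝ {p : ℝ × ℝ | s - ε ≤ p.1 ∧ p.1 < p.2 ∧ p.2 ≤ s + ε} := by
      rintro ⟨a, b⟩ ⟨h1, h2, h3⟩ ⟨a', b'⟩ ⟨h4, h5, h6⟩ u v hu hv huv
      obtain rfl : v = 1 - u := by linarith
      simp only [mem_ofPred_eq, Prod.smul_mk, Prod.mk_add_mk, smul_eq_mul] at *
      refine ⟨by nlinarith, ?_, by nlinarith⟩
      rcases eq_or_lt_of_le hu with h7 | h7
      · rw [← h7]; linarith
      · nlinarith
    have hq : ∀ p ∈ {p : ℝ × ℝ | s - ε ≤ p.1 ∧ p.1 < p.2 ∧ p.2 ≤ s + ε},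
        0 < ρ p.2 - ρ p.1 ∧ (Γ p.2 - Γ p.1) / e = ((ρ p.2 - ρ p.1 : ℝ) : ℂ) := by
      rintro p ⟨h1, h2, h3⟩
      have h4 : p.1 ∈ Icc (s - ε) (s + ε) := ⟨h1, by linarith⟩
      have h5 : p.2 ∈ Icc (s - ε) (s + ε) := ⟨by linarith, h3⟩
      refine ⟨sub_pos.2 (hρ h4 h5 h2), ?_⟩
      rw [hΓρ _ h4, hΓρ _ h5]; push_cast; field_simp; ring
    have h1 := hS.isPreconnected.sub_eq_of_exp_eq (A := Θ)
      (B := fun p => Complex.log ((Γ p.2 - Γ p.1) / e) + Complex.log e)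
      (x := (s, s + ε)) (y := (s - ε, s)) (hΘ.mono fun p hp => hp.2.1) ?_ ?_ ?_ ?_
    · simp only at h1
      have h2 := hq (s, s + ε) ⟨by simp; linarith, by simp; linarith, le_rfl⟩
      have h3 := hq (s - ε, s) ⟨le_rfl, by simp; linarith, by simp; linarith⟩
      simp only at h2 h3
      rw [h2.2, h3.2] at h1
      have h4 := congrArg Complex.im h1
      simp only [Complex.sub_im, Complex.add_im, Complex.log_im,
        Complex.arg_ofReal_of_nonneg h2.1.le, Complex.arg_ofReal_of_nonneg h3.1.le] at h4
      linarith
    · refine (ContinuousOn.clog (by fun_prop) fun p hp => Or.inl ?_).add continuousOn_const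
      rw [(hq p hp).2, Complex.ofReal_re]; exact (hq p hp).1
    · intro p hp
      rw [hΘΓ p hp.2.1, Complex.exp_add, Complex.exp_log he, Complex.exp_log]
      · field_simp
      · rw [(hq p hp).2]; exact_mod_cast (hq p hp).1.ne'
    · exact ⟨by simp; linarith, by simp; linarith, le_rfl⟩
    · exact ⟨le_rfl, by simp; linarith, by simp; linarith⟩
  have hsmall : ∀ᶠ δ : ℝ in 𝓝[>] 0, δ < m / ‖e‖ :=
    nhdsWithin_le_nhds (eventually_lt_nhds (by positivity))
  filter_upwards [hsmall, self_mem_nhdsWithin] with δ hδm hδ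
  replace hδ : 0 < δ := hδ
  rw [lt_div_iff₀ hne] at hδm
  have hratio : ∀ t, ε ≤ |t - s| → ‖(-(δ * Complex.I * e)) / (Γ t - Γ s)‖ < 1 := fun t ht => by
    have h1 := hms t ht
    rw [dist_eq_norm] at h1
    rw [norm_div, div_lt_one (hm.trans_le h1)]
    simp only [norm_neg, norm_mul, Complex.norm_real, Real.norm_of_nonneg hδ.le, Complex.norm_I]
    linarith
  have hsl := fun t ht => Complex.mem_slitPlane_of_norm_lt_one (hratio t ht)
  have hΓs : ∀ t, ε ≤ |t - s| → Γ t - Γ s ≠ 0 := fun t ht h0 => by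
    rw [h.injective (sub_eq_zero.1 h0)] at ht
    simp at ht; linarith
  have hdiv : ∀ t ∈ Icc (s - ε) (s + ε), (Γ t - Γ s) / e = ρ t := fun t ht => by
    rw [hΓρ t ht]; field_simp; ring
  have hq : ∀ t, Γ t - (Γ s + δ * Complex.I * e) ≠ 0 := fun t h0 => by
    by_cases ht : t ∈ Icc (s - ε) (s + ε)
    · rw [hΓρ t ht] at h0
      have h1 : (ρ t - δ * Complex.I) * e = 0 := by linear_combination h0
      have h2 := congrArg Complex.im ((mul_eq_zero.1 h1).resolve_right he)
      simp at h2
      exact hδ.ne' h2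
    · have ht' : ε ≤ |t - s| := by
        rw [mem_Icc, not_and_or, not_le, not_le] at ht
        rcases ht with ht | ht
        · rw [abs_of_neg (by linarith)]; linarith
        · rw [abs_of_pos (by linarith)]; linarith
      refine Complex.slitPlane_ne_zero (hsl t ht') ?_
      have := hΓs t ht'
      field_simp
      linear_combination h0
  obtain ⟨A, hA, hAΓ⟩ := exists_continuous_log
    (g := fun t => Γ t - (Γ s + δ * Complex.I * e)) (by fun_prop) hq
  let l : ℝ → ℂ := fun t => Complex.log (1 + -(δ * Complex.I * e) / (Γ t - Γ s))
  have hl : ContinuousOn l {t | ε ≤ |t - s|} := ContinuousOn.clog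
    (continuousOn_const.add (continuousOn_const.div (by fun_prop) hΓs)) hsl
  have hlexp : ∀ t, ε ≤ |t - s| →
      Complex.exp (l t) = (Γ t - (Γ s + δ * Complex.I * e)) / (Γ t - Γ s) := fun t ht => by
    have := hΓs t ht
    simp only [l]
    rw [Complex.exp_log (Complex.slitPlane_ne_zero (hsl t ht))]
    field_simp; ring
  have habs : ∀ t, s + ε ≤ t → ε ≤ |t - s| := fun t ht => by
    rw [abs_of_nonneg (by linarith)]; linarith
  have habs' : ∀ t, t ≤ s - ε → ε ≤ |t - s| := fun t ht => by
    rw [abs_of_nonpos (by linarith)]; linarith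
  have hright : ∀ T ≥ s + ε,
      A T - (Θ (s, T) + l T) = A (s + ε) - (Θ (s, s + ε) + l (s + ε)) := fun T hT => by
    refine isPreconnected_Ici.sub_eq_of_exp_eq (S := Ici (s + ε)) (A := A)
      (B := fun t => Θ (s, t) + l t) hA.continuousOn
      (ContinuousOn.add (hΘ.comp (by fun_prop) fun t ht => ?_) (hl.mono fun t ht => habs t ht))
      (fun t ht => ?_) hT self_mem_Ici
    · have : s + ε ≤ t := ht
      simp only [mem_ofPred_eq]; linarith
    · have h1 : s + ε ≤ t := ht
      rw [hAΓ, Complex.exp_add, hΘΓ (s, t) (by simp only; linarith), hlexp t (habs t ht),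
        mul_div_cancel₀ _ (hΓs t (habs t ht))]
  -- Before `s` the secant recorded by `Θ` is `Γ s - Γ S`, the opposite of `Γ S - Γ s`; `π * I`
  -- accounts for the sign.
  have hleft : ∀ S ≤ s - ε,
      A S - (Θ (S, s) + Real.pi * Complex.I + l S) =
        A (s - ε) - (Θ (s - ε, s) + Real.pi * Complex.I + l (s - ε)) := fun S hS => by
    refine isPreconnected_Iic.sub_eq_of_exp_eq (S := Iic (s - ε)) (A := A)
      (B := fun t => Θ (t, s) + Real.pi * Complex.I + l t) hA.continuousOn
      (ContinuousOn.add (ContinuousOn.add (hΘ.comp (by fun_prop) fun t ht => ?_)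
        continuousOn_const) (hl.mono fun t ht => habs' t ht))
      (fun t ht => ?_) hS self_mem_Iic
    · have : t ≤ s - ε := ht
      simp only [mem_ofPred_eq]; linarith
    · have h1 : t ≤ s - ε := ht
      rw [hAΓ, Complex.exp_add, Complex.exp_add, Complex.exp_pi_mul_I,
        hΘΓ (t, s) (by simp only; linarith), hlexp t (habs' t ht)]
      have := hΓs t (habs' t ht)
      simp only; field_simp; ring
  -- Measured from the direction `-I * e`, the straight piece seen from the displaced point has
  -- constant real part `δ > 0`, so the principal logarithm is available on all of it.
  have hmid : A (s + ε) - (Complex.log (δ + ρ (s + ε) * Complex.I) + Complex.log (-Complex.I * e))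
      = A (s - ε) - (Complex.log (δ + ρ (s - ε) * Complex.I) + Complex.log (-Complex.I * e)) := by
    rw [← hdiv _ hrm, ← hdiv _ hlm]
    refine isPreconnected_Icc.sub_eq_of_exp_eq (S := Icc (s - ε) (s + ε)) (A := A)
      (B := fun t => Complex.log (δ + (Γ t - Γ s) / e * Complex.I) + Complex.log (-Complex.I * e))
      hA.continuousOn (ContinuousOn.add (ContinuousOn.clog (by fun_prop) fun t ht => ?_)
        continuousOn_const) (fun t ht => ?_) hrm hlm
    · rw [hdiv t ht]; exact Or.inl (by simpa)
    · rw [hAΓ, Complex.exp_add, Complex.exp_log (mul_ne_zero (by simp) he), hdiv t ht,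
        Complex.exp_log, hΓρ t ht]
      · linear_combination (ρ t * e : ℂ) * Complex.I_sq
      · intro h0
        exact hδ.ne' (by simpa using congrArg Complex.re h0)
  have hlval : ∀ t ∈ Icc (s - ε) (s + ε), ρ t ≠ 0 →
      (l t).im = (1 - (δ / ρ t : ℝ) * Complex.I : ℂ).arg := fun t ht h0 => by
    have h0' : (ρ t : ℂ) ≠ 0 := by exact_mod_cast h0
    simp only [l, Complex.log_im]
    congr 1
    rw [hΓρ t ht]; push_cast; field_simp; ring
  refine ⟨A, hA, hAΓ, ?_⟩
  have hT1 := (h.tendsto_arg_atTop s).comp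
    (tendsto_fst (f := (atTop : Filter ℝ)) (g := (atBot : Filter ℝ)))
  have hS1 := (h.tendsto_arg_atBot s).comp
    (tendsto_snd (f := (atTop : Filter ℝ)) (g := (atBot : Filter ℝ)))
  have hT2 := (tendsto_log_ratio (h.tendsto_norm_sub_atTop (Γ s)) (-(δ * Complex.I * e))).comp
    (tendsto_fst (f := (atTop : Filter ℝ)) (g := (atBot : Filter ℝ)))
  have hS2 := (tendsto_log_ratio (h.tendsto_norm_sub_atBot (Γ s)) (-(δ * Complex.I * e))).comp
    (tendsto_snd (f := (atTop : Filter ℝ)) (g := (atBot : Filter ℝ)))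
  have hlim := (((hT1.sub hS1).add (hT2.sub hS2)).add_const Real.pi)
  simp only [sub_zero, add_zero, zero_add] at hlim
  refine hlim.congr' ?_
  filter_upwards [h.eventually_secant_log_eq hΘ hΘΓ s,
    (eventually_ge_atTop (s + ε)).prod_mk (eventually_le_atBot (s - ε))] with p hp hp2
  have e1 := congrArg Complex.im (hright p.1 hp2.1)
  have e2 := congrArg Complex.im (hleft p.2 hp2.2)
  have e3 := congrArg Complex.im hmid
  have e4 := congrArg Complex.im hp
  have e5 := hlval _ hrm hρr.ne'
  have e6 := hlval _ hlm hρl.ne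
  have e7 := arg_add_mul_I_of_pos hδ hρr
  have e8 := arg_add_mul_I_of_neg hδ hρl
  have e9 : (l p.1).im = (Complex.log (1 + -(δ * Complex.I * e) / (Γ p.1 - Γ s))).im := rfl
  have e10 : (l p.2).im = (Complex.log (1 + -(δ * Complex.I * e) / (Γ p.2 - Γ s))).im := rfl
  simp only [Complex.sub_im, Complex.add_im] at e1 e2 e3 e4
  simp only [Complex.log_im] at e3 e4
  simp only [Function.comp]
  linarith

theorem eventually_hasTurning_right {s ε : ℝ} (hε : 0 < ε) {e : ℂ} (he : e ≠ 0) {ρ : ℝ → ℝ}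
    (hρ : StrictMonoOn ρ (Icc (s - ε) (s + ε)))
    (hΓρ : ∀ t ∈ Icc (s - ε) (s + ε), Γ t = Γ s + ρ t * e) :
    ∀ᶠ δ : ℝ in 𝓝[>] 0, HasTurning Γ (Γ s - δ * Complex.I * e) (-Real.pi) := by
  filter_upwards [h.conj.eventually_hasTurning_left hε (e := starRingEnd ℂ e) (by simpa) hρ
    (fun t ht => by rw [hΓρ t ht]; simp)] with δ hδ
  refine HasTurning.of_conj ?_
  convert! hδ using 1
  simp

end RightwardLine

end Jump

/-! ### The two sides of a line near one of its points. -/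

section Sectors

open Filter Topology Metric

theorem exists_mem_Ico_polar (w : ℂ) :
    ∃ φ ∈ Ico 0 (2 * Real.pi), w = ‖w‖ * Complex.exp (φ * Complex.I) := by
  have hpi := Real.pi_pos
  rcases le_or_gt 0 w.arg with h | h
  · exact ⟨w.arg, ⟨h, by linarith [Complex.arg_le_pi w]⟩, (Complex.norm_mul_exp_arg_mul_I w).symm⟩
  · refine ⟨w.arg + 2 * Real.pi, ⟨by linarith [Complex.neg_pi_lt_arg w], by linarith⟩, ?_⟩
    push_cast
    rw [add_mul, Complex.exp_add, Complex.exp_two_pi_mul_I, mul_one,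
      Complex.norm_mul_exp_arg_mul_I]

theorem eq_of_exp_mul_I_eq {φ ψ : ℝ} (h : |φ - ψ| < 2 * Real.pi)
    (he : Complex.exp (φ * Complex.I) = Complex.exp (ψ * Complex.I)) : φ = ψ := by
  obtain ⟨n, hn⟩ := Complex.exp_eq_exp_iff_exists_int.1 he
  have h1 : φ = ψ + n * (2 * Real.pi) := by
    have := congrArg Complex.im hn
    simpa using this
  have hpi := Real.pi_pos
  rw [h1, add_sub_cancel_left, abs_mul, abs_of_pos (by positivity : 0 < 2 * Real.pi)] at h
  have h2 : |(n : ℝ)| < 1 := by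
    by_contra h3
    rw [not_lt] at h3
    nlinarith
  have h3 : n = 0 := Int.abs_lt_one_iff.1 (by exact_mod_cast h2)
  rw [h1, h3]; simp

/-- The open circular sector with apex `z` between the angles `α` and `β`, measured from the
direction `e`. -/
def sector (z e : ℂ) (R α β : ℝ) : Set ℂ :=
  (fun p : ℝ × ℝ => z + p.1 * (e * Complex.exp (p.2 * Complex.I))) '' (Ioo 0 R ×ˢ Ioo α β)

theorem isPreconnected_sector (z e : ℂ) (R α β : ℝ) : IsPreconnected (sector z e R α β) :=
  (isPreconnected_Ioo.prod isPreconnected_Ioo).image _ (by fun_prop)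

theorem sector_subset_ball (z : ℂ) {e : ℂ} (he : ‖e‖ = 1) (R α β : ℝ) :
    sector z e R α β ⊆ ball z R := by
  rintro _ ⟨⟨r, φ⟩, ⟨hr, hφ⟩, rfl⟩
  rw [mem_ball, dist_eq_norm]
  simp only [add_sub_cancel_left, norm_mul, he, Complex.norm_exp_ofReal_mul_I,
    Complex.norm_real, Real.norm_of_nonneg hr.1.le, mul_one]
  exact hr.2

variable {Γ : ℝ → ℂ}

namespace RightwardLine

variable (h : RightwardLine Γ)
include h

/-- The distance to `Γ s` serves as parameter on the cone; it determines the point, so simplicity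
makes it injective and therefore monotone. -/
theorem exists_param_right (s : ℝ) : ∃ ε > 0, ∃ e : ℂ, ‖e‖ = 1 ∧ ∃ ρ : ℝ → ℝ, ρ s = 0 ∧
    Continuous ρ ∧ StrictMonoOn ρ (Icc s (s + ε)) ∧
      ∀ t ∈ Icc s (s + ε), Γ t = Γ s + ρ t * e := by
  obtain ⟨ε, hε, e, he⟩ := h.cone_right s
  have hΓ := h.continuous
  have hs : s ∈ Icc s (s + ε) := ⟨le_rfl, by linarith⟩
  have hsε : s + ε ∈ Icc s (s + ε) := ⟨by linarith, le_rfl⟩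
  have he0 : e ≠ 0 := by
    rintro rfl
    obtain ⟨r, -, h1⟩ := he _ hsε
    rw [mul_zero, add_zero] at h1
    linarith [h.injective h1]
  have hn : (‖e‖ : ℂ) ≠ 0 := by exact_mod_cast norm_ne_zero_iff.2 he0
  refine ⟨ε, hε, e / ‖e‖, ?_, fun t => ‖Γ t - Γ s‖, by simp, by fun_prop, ?_, ?_⟩
  · rw [norm_div, Complex.norm_real, norm_norm, div_self (norm_ne_zero_iff.2 he0)]
  all_goals
    have key : ∀ t ∈ Icc s (s + ε), Γ t = Γ s + (‖Γ t - Γ s‖ : ℂ) * (e / ‖e‖) := by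
      intro t ht
      obtain ⟨r, hr, h1⟩ := he t ht
      have h2 : ‖Γ t - Γ s‖ = r * ‖e‖ := by
        rw [h1, add_sub_cancel_left, norm_mul, Complex.norm_real, Real.norm_of_nonneg hr]
      rw [h2, h1]; push_cast; field_simp
  · refine ContinuousOn.strictMonoOn_of_injOn_Icc (by linarith) (by simp) (by fun_prop) ?_
    intro t ht t' ht' htt
    simp only at htt
    have h1 := key t ht
    rw [htt, ← key t' ht'] at h1
    exact h.injective h1
  · exact key

theorem exists_param_left (s : ℝ) : ∃ ε > 0, ∃ e : ℂ, ‖e‖ = 1 ∧ ∃ ρ : ℝ → ℝ, ρ s = 0 ∧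
    Continuous ρ ∧ StrictAntiOn ρ (Icc (s - ε) s) ∧
      ∀ t ∈ Icc (s - ε) s, Γ t = Γ s + ρ t * e := by
  obtain ⟨ε, hε, e, he, ρ, hρ0, hρ, hmono, hΓρ⟩ := h.reverse.exists_param_right (-s)
  refine ⟨ε, hε, -e, by simpa, fun t => ρ (-t), hρ0, by fun_prop, ?_, ?_⟩
  · intro a ha b hb hab
    exact hmono ⟨by linarith [hb.2], by linarith [hb.1]⟩ ⟨by linarith [ha.2], by linarith [ha.1]⟩
      (neg_lt_neg hab)
  · intro t ht
    have := hΓρ (-t) ⟨by linarith [ht.2], by linarith [ht.1]⟩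
    simp only [neg_neg] at this
    linear_combination -this

/-- Near each of its points the curve separates the plane into two connected sides. -/
theorem exists_sides (s : ℝ) {R₀ : ℝ} (hR₀ : 0 < R₀) :
    ∃ R > 0, R ≤ R₀ ∧ ∃ C C' : Set ℂ, IsPreconnected C ∧ IsPreconnected C' ∧
      C.Nonempty ∧ C'.Nonempty ∧ Disjoint C (range Γ) ∧ Disjoint C' (range Γ) ∧
      C ⊆ ball (Γ s) R ∧ C' ⊆ ball (Γ s) R ∧ ball (Γ s) R \ range Γ ⊆ C ∪ C' ∧
      (∀ q ∈ C, HasTurning Γ q Real.pi) ∧ ∀ q ∈ C', HasTurning Γ q (-Real.pi) := by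
  have hpi := Real.pi_pos
  obtain ⟨ε, hε, e, he, ρ, hρ0, hρ, hmono, hΓρ⟩ := h.exists_param_right s
  obtain ⟨ε', hε', e', he', ρ', hρ0', hρ', hanti, hΓρ'⟩ := h.exists_param_left s
  have he0 : e ≠ 0 := norm_ne_zero_iff.1 (by rw [he]; exact one_ne_zero)
  obtain ⟨m, hm, hms⟩ := h.exists_dist_ge s (lt_min hε hε')
  have hρpos : 0 < ρ (s + ε) :=
    hρ0 ▸ hmono ⟨le_rfl, by linarith⟩ ⟨by linarith, le_rfl⟩ (by linarith)
  have hρpos' : 0 < ρ' (s - ε') :=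
    hρ0' ▸ hanti ⟨le_rfl, by linarith⟩ ⟨by linarith, le_rfl⟩ (by linarith)
  -- `R ≤ m` keeps distant parameters out of the ball; the other two bounds make both arms reach its
  -- boundary. Inside the ball the curve is then exactly two radii.
  obtain ⟨R, hR, hR0, hRm, hRρ, hRρ'⟩ : ∃ R > 0, R ≤ R₀ ∧ R ≤ m ∧ R ≤ ρ (s + ε) ∧
      R ≤ ρ' (s - ε') :=
    ⟨min (min R₀ m) (min (ρ (s + ε)) (ρ' (s - ε'))), by positivity,
      (min_le_left _ _).trans (min_le_left _ _), (min_le_left _ _).trans (min_le_right _ _),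
      (min_le_right _ _).trans (min_le_left _ _), (min_le_right _ _).trans (min_le_right _ _)⟩
  have hcover : ∀ r, 0 ≤ r → r ≤ R → ∃ t ∈ Icc s (s + ε), ρ t = r := fun r h0 h1 =>
    intermediate_value_Icc (by linarith) hρ.continuousOn ⟨by rwa [hρ0], h1.trans hRρ⟩
  have hcover' : ∀ r, 0 ≤ r → r ≤ R → ∃ t ∈ Icc (s - ε') s, ρ' t = r := fun r h0 h1 =>
    intermediate_value_Icc' (by linarith) hρ'.continuousOn ⟨by rwa [hρ0'], h1.trans hRρ'⟩
  have hlocal : ∀ w ∈ ball (Γ s) R, w ∈ range Γ → ∃ r : ℝ, 0 ≤ r ∧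
      (w = Γ s + r * e ∨ w = Γ s + r * e') := by
    rintro _ hw ⟨t, rfl⟩
    have hts : |t - s| < min ε ε' := by
      by_contra h1
      exact absurd hw (not_lt.2 (hRm.trans (hms t (not_lt.1 h1))))
    rw [lt_min_iff, abs_lt, abs_lt] at hts
    rcases le_total s t with hst | hst
    · have ht : t ∈ Icc s (s + ε) := ⟨hst, by linarith [hts.1.2]⟩
      refine ⟨ρ t, hρ0 ▸ hmono.monotoneOn ⟨le_rfl, by linarith⟩ ht hst, Or.inl (hΓρ t ht)⟩
    · have ht : t ∈ Icc (s - ε') s := ⟨by linarith [hts.2.1], hst⟩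
      refine ⟨ρ' t, hρ0' ▸ hanti.antitoneOn ht ⟨by linarith, le_rfl⟩ hst, Or.inr (hΓρ' t ht)⟩
  have hee : e' ≠ e := by
    rintro rfl
    obtain ⟨t, ht, htR⟩ := hcover R hR.le le_rfl
    obtain ⟨t', ht', htR'⟩ := hcover' R hR.le le_rfl
    have h1 := h.injective ((hΓρ t ht).trans (by rw [htR, ← htR', ← hΓρ' t' ht']))
    obtain rfl : t = s := by linarith [ht.1, ht'.2]
    linarith
  obtain ⟨β, hβ, heβ⟩ := exists_mem_Ico_polar (e' / e)
  rw [norm_div, he, he', div_one, Complex.ofReal_one, one_mul, div_eq_iff he0, mul_comm] at heβ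
  have hβ0 : 0 < β := lt_of_le_of_ne hβ.1 fun h0 => hee (by rw [heβ, ← h0]; simp)
  have hinj : ∀ {r φ r' ψ : ℝ}, 0 < r → 0 ≤ r' → r * (e * Complex.exp (φ * Complex.I)) =
      r' * (e * Complex.exp (ψ * Complex.I)) → |φ - ψ| < 2 * Real.pi → φ = ψ := by
    intro r φ r' ψ hr hr' heq hlt
    have h1 := congrArg norm heq
    simp only [norm_mul, he, Complex.norm_exp_ofReal_mul_I, Complex.norm_real,
      Real.norm_of_nonneg hr.le, Real.norm_of_nonneg hr', mul_one] at h1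
    rw [← h1] at heq
    have hr0 : (r : ℂ) ≠ 0 := by exact_mod_cast hr.ne'
    exact eq_of_exp_mul_I_eq hlt (mul_left_cancel₀ he0 (mul_left_cancel₀ hr0 heq))
  have hdisj : ∀ α α', 0 ≤ α → α' ≤ 2 * Real.pi → β ∉ Ioo α α' →
      Disjoint (sector (Γ s) e R α α') (range Γ) := by
    intro α α' h0 h1 hβα
    rw [disjoint_left]
    intro w hw hwΓ
    obtain ⟨r', hr', hwr⟩ := hlocal w (sector_subset_ball _ he _ _ _ hw) hwΓ
    obtain ⟨⟨r, φ⟩, ⟨hr, hφ⟩, rfl⟩ := hw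
    simp only [add_right_inj] at hwr hr hφ
    rcases hwr with hwr | hwr
    · have := hinj (ψ := 0) hr.1 hr' (by rw [hwr]; simp)
        (by rw [sub_zero, abs_of_pos (by linarith [hφ.1])]; linarith [hφ.2])
      linarith [hφ.1]
    · have := hinj hr.1 hr' (by rw [hwr, heβ])
        (by rw [abs_lt]; constructor <;> linarith [hφ.1, hφ.2, hβ.1, hβ.2])
      exact hβα (this ▸ hφ)
  have hdisj1 := hdisj 0 β le_rfl hβ.2.le fun h0 => lt_irrefl _ h0.2
  have hdisj2 := hdisj β (2 * Real.pi) hβ.1 le_rfl fun h0 => lt_irrefl _ h0.1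
  -- `Γ s` may be a corner, so the turning is computed beside the midpoint of one radius, where the
  -- curve is straight. That radius borders both sectors.
  obtain ⟨s₁, hs₁, hs₁R⟩ := hcover (R / 2) (by linarith) (by linarith)
  have hs₁s : s < s₁ := lt_of_le_of_ne hs₁.1 fun h0 => by rw [← h0, hρ0] at hs₁R; linarith
  have hs₁ε : s₁ < s + ε := lt_of_le_of_ne hs₁.2 fun h0 => by rw [h0] at hs₁R; linarith
  obtain ⟨η, hη, hη1, hη2⟩ : ∃ η > 0, η ≤ s₁ - s ∧ η ≤ s + ε - s₁ :=
    ⟨min (s₁ - s) (s + ε - s₁), lt_min (by linarith) (by linarith), min_le_left _ _,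
      min_le_right _ _⟩
  have hsubset : Icc (s₁ - η) (s₁ + η) ⊆ Icc s (s + ε) :=
    Icc_subset_Icc (by linarith) (by linarith)
  have hmono1 : StrictMonoOn (fun t => ρ t - R / 2) (Icc (s₁ - η) (s₁ + η)) :=
    fun a ha b hb hab => sub_lt_sub_right (hmono (hsubset ha) (hsubset hb) hab) _
  have hΓ1 : ∀ t ∈ Icc (s₁ - η) (s₁ + η), Γ t = Γ s₁ + (ρ t - R / 2 : ℝ) * e := fun t ht => by
    rw [hΓρ t (hsubset ht), hΓρ s₁ hs₁, hs₁R]; push_cast; ring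
  have hnorm : ∀ σ : ℝ, ∀ᶠ δ : ℝ in 𝓝[>] 0,
      ‖(R / 2 + σ * δ * Complex.I : ℂ)‖ ∈ Ioo 0 R := fun σ => by
    have hc : ContinuousAt (fun δ : ℝ => ‖(R / 2 + σ * δ * Complex.I : ℂ)‖) 0 := by fun_prop
    refine nhdsWithin_le_nhds (hc.eventually (isOpen_Ioo.mem_nhds ?_))
    have : ‖(R / 2 : ℂ)‖ = R / 2 := by
      rw [show (R / 2 : ℂ) = ((R / 2 : ℝ) : ℂ) by push_cast; rfl, Complex.norm_real,
        Real.norm_of_nonneg (by linarith)]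
    simp only [Complex.ofReal_zero, mul_zero, zero_mul, add_zero, this]
    constructor <;> linarith
  have harg : ∀ σ : ℝ, ∀ η > 0, ∀ᶠ δ : ℝ in 𝓝[>] 0,
      |(R / 2 + σ * δ * Complex.I : ℂ).arg| < η := fun σ η hη => by
    have hc : ContinuousAt (fun δ : ℝ => (R / 2 + σ * δ * Complex.I : ℂ).arg) 0 := by
      refine ContinuousAt.comp (g := Complex.arg) (Complex.continuousAt_arg (Or.inl ?_))
        (by fun_prop)
      simp [hR]
    have h0 : (R / 2 + σ * (0 : ℝ) * Complex.I : ℂ).arg = 0 := by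
      rw [show (R / 2 + σ * (0 : ℝ) * Complex.I : ℂ) = ((R / 2 : ℝ) : ℂ) by push_cast; ring]
      exact Complex.arg_ofReal_of_nonneg (by linarith)
    have := hc.abs.eventually (isOpen_Iio.mem_nhds (show |_| < η by rw [h0]; simpa))
    exact nhdsWithin_le_nhds this
  obtain ⟨q, hq, hqσ⟩ : ∃ q ∈ sector (Γ s) e R 0 β, HasTurning Γ q Real.pi := by
    obtain ⟨δ, ⟨⟨h1, h2⟩, h3⟩, h4⟩ := (((h.eventually_hasTurning_left hη he0 hmono1 hΓ1).and
      (hnorm 1)).and (harg 1 β hβ0)).and self_mem_nhdsWithin |>.exists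
    replace h4 : 0 < δ := h4
    refine ⟨_, ⟨(‖(R / 2 + (1 : ℝ) * δ * Complex.I : ℂ)‖,
      (R / 2 + (1 : ℝ) * δ * Complex.I : ℂ).arg), ⟨h2, ?_, (le_abs_self _).trans_lt h3⟩, rfl⟩, ?_⟩
    · refine lt_of_le_of_ne (Complex.arg_nonneg_iff.2 (by simp [h4.le])) fun h5 => ?_
      have := (Complex.arg_eq_zero_iff.1 h5.symm).2
      simp at this
      exact h4.ne' this
    · convert! h1 using 1
      simp only
      rw [mul_left_comm, Complex.norm_mul_exp_arg_mul_I, hΓρ s₁ hs₁, hs₁R]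
      push_cast; ring
  obtain ⟨q', hq', hqσ'⟩ : ∃ q ∈ sector (Γ s) e R β (2 * Real.pi),
      HasTurning Γ q (-Real.pi) := by
    obtain ⟨δ, ⟨⟨h1, h2⟩, h3⟩, h4⟩ := (((h.eventually_hasTurning_right hη he0 hmono1 hΓ1).and
      (hnorm (-1))).and (harg (-1) (2 * Real.pi - β) (by linarith [hβ.2]))).and
      self_mem_nhdsWithin |>.exists
    replace h4 : 0 < δ := h4
    refine ⟨_, ⟨(‖(R / 2 + (-1 : ℝ) * δ * Complex.I : ℂ)‖,
      (R / 2 + (-1 : ℝ) * δ * Complex.I : ℂ).arg + 2 * Real.pi),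
      ⟨h2, by linarith [(abs_lt.1 h3).1], ?_⟩, rfl⟩, ?_⟩
    · have : (R / 2 + (-1 : ℝ) * δ * Complex.I : ℂ).arg < 0 :=
        Complex.arg_neg_iff.2 (by simp [h4])
      simp only; linarith
    · convert! h1 using 1
      simp only
      rw [Complex.ofReal_add, add_mul, Complex.exp_add]
      push_cast
      rw [Complex.exp_two_pi_mul_I, mul_one, mul_left_comm]
      have := Complex.norm_mul_exp_arg_mul_I (R / 2 + -1 * δ * Complex.I : ℂ)
      rw [this, hΓρ s₁ hs₁, hs₁R]
      push_cast; ring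
  refine ⟨R, hR, hR0, sector (Γ s) e R 0 β, sector (Γ s) e R β (2 * Real.pi),
    isPreconnected_sector _ _ _ _ _, isPreconnected_sector _ _ _ _ _, ⟨q, hq⟩, ⟨q', hq'⟩,
    hdisj1, hdisj2, sector_subset_ball _ he _ _ _, sector_subset_ball _ he _ _ _, ?_,
    h.hasTurning_of_isPreconnected (isPreconnected_sector _ _ _ _ _) hdisj1 hq hqσ,
    h.hasTurning_of_isPreconnected (isPreconnected_sector _ _ _ _ _) hdisj2 hq' hqσ'⟩
  rintro w ⟨hw, hwΓ⟩
  obtain ⟨φ, hφ, hwφ⟩ := exists_mem_Ico_polar ((w - Γ s) / e)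
  have hwn : ‖(w - Γ s) / e‖ = ‖w - Γ s‖ := by rw [norm_div, he, div_one]
  rw [hwn, div_eq_iff he0] at hwφ
  have hr : ‖w - Γ s‖ ∈ Ioo 0 R :=
    ⟨norm_pos_iff.2 (sub_ne_zero.2 fun h0 => hwΓ (h0 ▸ mem_range_self s)), by
      rwa [mem_ball, dist_eq_norm] at hw⟩
  have hw' : w = Γ s + ‖w - Γ s‖ * (e * Complex.exp (φ * Complex.I)) := by
    linear_combination hwφ
  have hφ0 : φ ≠ 0 := by
    rintro rfl
    obtain ⟨t, ht, htr⟩ := hcover _ hr.1.le hr.2.le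
    refine hwΓ ⟨t, ?_⟩
    rw [hΓρ t ht, htr]
    simpa using hw'.symm
  have hφβ : φ ≠ β := by
    rintro rfl
    obtain ⟨t, ht, htr⟩ := hcover' _ hr.1.le hr.2.le
    refine hwΓ ⟨t, ?_⟩
    rw [hΓρ' t ht, htr, heβ, ← hw']
  rcases lt_or_gt_of_ne hφβ with hlt | hlt
  · exact Or.inl ⟨(‖w - Γ s‖, φ), ⟨hr, lt_of_le_of_ne hφ.1 hφ0.symm, hlt⟩, hw'.symm⟩
  · exact Or.inr ⟨(‖w - Γ s‖, φ), ⟨hr, hlt, hφ.2⟩, hw'.symm⟩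

/-- The turning number of the curve around a point off the curve is `π` or `-π`. -/
theorem hasTurning_or {q : ℂ} (hq : q ∉ range Γ) :
    HasTurning Γ q Real.pi ∨ HasTurning Γ q (-Real.pi) := by
  obtain ⟨_, ⟨s, rfl⟩, hs⟩ :=
    h.isClosed_range.exists_infDist_eq_dist (range_nonempty Γ) q
  obtain ⟨R, hR, -, C, C', -, -, -, -, -, -, -, -, hCC, hC, hC'⟩ := h.exists_sides s one_pos
  have hqs : 0 < dist q (Γ s) := dist_pos.2 fun h0 => hq (h0 ▸ mem_range_self s)
  -- The segment from `q` to a nearest point of the curve misses the curve before its end, and it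
  -- enters one of the two sides there.
  let S : Set ℂ := (fun t : ℝ => Γ s + t * (q - Γ s)) '' Ioc 0 1
  have hS : IsPreconnected S := isPreconnected_Ioc.image _ (by fun_prop)
  have hSΓ : Disjoint S (range Γ) := by
    rw [disjoint_left]
    rintro _ ⟨t, ht, rfl⟩ hmem
    have h1 := infDist_le_dist_of_mem (x := q) hmem
    simp only at h1
    rw [hs, dist_eq_norm q (_ + _), show q - (Γ s + t * (q - Γ s)) = ((1 - t : ℝ) : ℂ) * (q - Γ s) by
      push_cast; ring, norm_mul, Complex.norm_real, Real.norm_of_nonneg (by linarith [ht.2]),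
      ← dist_eq_norm] at h1
    nlinarith [ht.1]
  have hqS : q ∈ S := ⟨1, ⟨one_pos, le_rfl⟩, by simp⟩
  obtain ⟨t, ht0, ht1, htR⟩ : ∃ t : ℝ, 0 < t ∧ t ≤ 1 ∧ t * dist q (Γ s) < R := by
    refine ⟨min 1 (R / (2 * dist q (Γ s))), by positivity, min_le_left _ _, ?_⟩
    refine (mul_le_mul_of_nonneg_right (min_le_right _ _) hqs.le).trans_lt ?_
    field_simp; linarith
  have hwS : Γ s + t * (q - Γ s) ∈ S := ⟨t, ⟨ht0, ht1⟩, rfl⟩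
  have hwR : Γ s + t * (q - Γ s) ∈ ball (Γ s) R := by
    rwa [mem_ball, dist_eq_norm, add_sub_cancel_left, norm_mul, Complex.norm_real,
      Real.norm_of_nonneg ht0.le, ← dist_eq_norm]
  rcases hCC ⟨hwR, disjoint_left.1 hSΓ hwS⟩ with hw | hw
  · exact Or.inl (h.hasTurning_of_isPreconnected hS hSΓ hwS (hC _ hw) q hqS)
  · exact Or.inr (h.hasTurning_of_isPreconnected hS hSΓ hwS (hC' _ hw) q hqS)

theorem dense_compl_range : Dense (range Γ)ᶜ := by
  rw [Metric.dense_iff]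
  intro q r hr
  by_cases hq : q ∈ range Γ
  · obtain ⟨s, rfl⟩ := hq
    obtain ⟨R, hR, hRr, C, C', -, -, ⟨w, hw⟩, -, hC, -, hCR, -⟩ := h.exists_sides s hr
    exact ⟨w, ball_subset_ball hRr (hCR hw), disjoint_left.1 hC hw⟩
  · exact ⟨q, mem_ball_self hr, hq⟩

end RightwardLine

end Sectors

/-! ### Injectivity of the disk from the turning of its two boundary lines. -/

section Disk

open Filter Topology Metric

theorem mem_arcs_of_mem_sphere (a b : ℝ) {u : ℂ}
    (hu : u ∈ sphere (0 : ℂ) 1) : u ∈ circleMap 0 1 '' Icc a b ∨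
      u ∈ circleMap 0 1 '' Icc b (a + 2 * Real.pi) := by
  have h1 : u ∈ range (circleMap 0 1) := by rwa [range_circleMap, abs_one]
  obtain ⟨t, rfl⟩ := h1
  obtain ⟨s, hs, hst⟩ := (periodic_circleMap 0 1).exists_mem_Ico Real.two_pi_pos t a
  rw [hst]
  rcases le_total s b with hsb | hsb
  · exact Or.inl ⟨s, ⟨hs.1, hsb⟩, rfl⟩
  · exact Or.inr ⟨s, ⟨hsb, hs.2.le⟩, rfl⟩

variable {F : ℂ → ℂ} {Γ₀ Γ₁ : ℝ → ℂ} {a b : ℝ}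

/-- Two lines `Γ₀` and `Γ₁` with common ends run along the boundary curve `F (circleMap 0 1 t)`:
`Γ₀` follows it on `[a, b]`, and `Γ₁` follows it backwards on `[b, a + 2π]`. -/
structure BoundaryLines (F : ℂ → ℂ) (Γ₀ Γ₁ : ℝ → ℂ) (a b : ℝ) : Prop where
  line₀ : RightwardLine Γ₀
  line₁ : RightwardLine Γ₁
  le₀ : a ≤ b
  le₁ : b ≤ a + 2 * Real.pi
  arc₀ : ∀ t ∈ Icc a b, Γ₀ t = F (circleMap 0 1 t)
  arc₁ : ∀ t ∈ Icc b (a + 2 * Real.pi), Γ₁ (-t) = F (circleMap 0 1 t)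
  right_ray : ∀ τ ≥ 0, Γ₀ (b + τ) = Γ₁ (-b + τ)
  left_ray : ∀ τ ≥ 0, Γ₀ (a - τ) = Γ₁ (-(a + 2 * Real.pi) - τ)

namespace BoundaryLines

/-- Run along `Γ₀` and back along `Γ₁`: the contributions of the shared rays cancel, and the closed
boundary curve remains. -/
theorem turning_sub_turning (h : BoundaryLines F Γ₀ Γ₁ a b) {q : ℂ} {σ₀ σ₁ : ℝ} {n : ℤ}
    (h₀ : HasTurning Γ₀ q σ₀) (h₁ : HasTurning Γ₁ q σ₁)
    (hn : HasWinding (fun t => F (circleMap 0 1 t) - q) n) : σ₀ - σ₁ = n * (2 * Real.pi) := by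
  obtain ⟨A, hA, hAΓ, hAlim⟩ := h₀
  obtain ⟨B, hB, hBΓ, hBlim⟩ := h₁
  obtain ⟨L, hL, hLF, hLn⟩ := hn
  have h01 := h.le₀
  have h02 := h.le₁
  have e1 : L b - A b = L a - A a :=
    isPreconnected_Icc.sub_eq_of_exp_eq (S := Icc a b) hL.continuousOn hA.continuousOn
      (fun t ht => by rw [hLF, hAΓ, h.arc₀ t ht]) ⟨h01, le_rfl⟩ ⟨le_rfl, h01⟩
  have e2 : L (a + 2 * Real.pi) - B (-(a + 2 * Real.pi)) = L b - B (-b) :=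
    isPreconnected_Icc.sub_eq_of_exp_eq (S := Icc b (a + 2 * Real.pi)) (B := fun t => B (-t))
      hL.continuousOn (by fun_prop)
      (fun t ht => by rw [hLF, hBΓ, h.arc₁ t ht]) ⟨h02, le_rfl⟩ ⟨le_rfl, h02⟩
  have e3 : ∀ τ ≥ 0, A (b + τ) - B (-b + τ) = A b - B (-b) := fun τ hτ => by
    have := isPreconnected_Ici.sub_eq_of_exp_eq (S := Ici (0 : ℝ)) (A := fun τ => A (b + τ))
      (B := fun τ => B (-b + τ)) (by fun_prop) (by fun_prop)
      (fun t ht => by rw [hAΓ, hBΓ, h.right_ray t ht]) hτ self_mem_Ici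
    simpa using this
  have e4 : ∀ τ ≥ 0, A (a - τ) - B (-(a + 2 * Real.pi) - τ) = A a - B (-(a + 2 * Real.pi)) :=
    fun τ hτ => by
    have := isPreconnected_Ici.sub_eq_of_exp_eq (S := Ici (0 : ℝ)) (A := fun τ => A (a - τ))
      (B := fun τ => B (-(a + 2 * Real.pi) - τ)) (by fun_prop) (by fun_prop)
      (fun t ht => by rw [hAΓ, hBΓ, h.left_ray t ht]) hτ self_mem_Ici
    simpa using this
  have hright : ∀ c : ℝ, Tendsto (fun τ : ℝ => c + τ) atTop atTop := fun c =>
    tendsto_atTop_add_const_left _ c tendsto_id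
  have hleft : ∀ c : ℝ, Tendsto (fun τ : ℝ => c - τ) atTop atBot := fun c => by
    simpa only [sub_eq_add_neg] using tendsto_atBot_add_const_left _ c tendsto_neg_atTop_atBot
  have l1 := hAlim.comp ((hright b).prodMk (hleft a))
  have l2 := hBlim.comp ((hright (-b)).prodMk (hleft (-(a + 2 * Real.pi))))
  refine tendsto_nhds_unique (l1.sub l2) (tendsto_const_nhds.congr' ?_)
  filter_upwards [eventually_ge_atTop 0] with τ hτ
  have e5 := hLn a
  have e6 : A (b + τ) - A (a - τ) - (B (-b + τ) - B (-(a + 2 * Real.pi) - τ)) =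
      n * (2 * Real.pi * Complex.I) := by
    linear_combination e3 τ hτ - e4 τ hτ - e1 - e2 + e5
  have e7 := congrArg Complex.im e6
  simp only [Function.comp]
  simpa using e7.symm

theorem apply_mem_range₀ (h : BoundaryLines F Γ₀ Γ₁ a b) {u : ℂ}
    (hu : u ∈ circleMap 0 1 '' Icc a b) : F u ∈ range Γ₀ := by
  obtain ⟨t, ht, rfl⟩ := hu
  exact ⟨t, h.arc₀ t ht⟩

theorem apply_mem_range₁ (h : BoundaryLines F Γ₀ Γ₁ a b) {u : ℂ}
    (hu : u ∈ circleMap 0 1 '' Icc b (a + 2 * Real.pi)) : F u ∈ range Γ₁ := by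
  obtain ⟨t, ht, rfl⟩ := hu
  exact ⟨-t, h.arc₁ t ht⟩

theorem injOn₀ (h : BoundaryLines F Γ₀ Γ₁ a b) : InjOn F (circleMap 0 1 '' Icc a b) := by
  rintro _ ⟨s, hs, rfl⟩ _ ⟨t, ht, rfl⟩ hst
  rw [← h.arc₀ s hs, ← h.arc₀ t ht] at hst
  rw [h.line₀.injective hst]

variable {ε : ℝ}

/-- The turnings are `k₀ * π` and `k₁ * π` with signs `k₀`, `k₁`, and `k₀ - k₁` is `2 * d` times the
number of preimages. Once there is a preimage, `d ≠ 0` allows only one and leaves only `k₁ = -d`. -/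
theorem exists_turning (h : BoundaryLines F Γ₀ Γ₁ a b) (hF : Continuous F) (hε : 0 < ε)
    (hinj : ∀ x ∈ closedBall (0 : ℂ) 1, ∀ y ∈ closedBall (0 : ℂ) 1, x ≠ y → dist x y < ε →
      F x ≠ F y) :
    ∃ τ : ℝ, ∀ q, q ∉ range Γ₀ → q ∉ range Γ₁ → ∀ x ∈ closedBall (0 : ℂ) 1, F x = q →
      HasTurning Γ₁ q τ ∧ ∀ y ∈ closedBall (0 : ℂ) 1, F y = q → x = y := by
  obtain ⟨d, hd0, hd⟩ := exists_degree hF hε hinj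
  refine ⟨-(d * Real.pi), fun q hq₀ hq₁ x hx hxq => ?_⟩
  obtain ⟨Z, hZ, hW⟩ := hd q fun z hz hzq => by
    rcases mem_arcs_of_mem_sphere a b hz with h1 | h1
    · exact hq₀ (hzq ▸ h.apply_mem_range₀ h1)
    · exact hq₁ (hzq ▸ h.apply_mem_range₁ h1)
  have hxZ : x ∈ Z := (hZ x).2 ⟨hx, hxq⟩
  have hpi := Real.pi_pos
  have key : ∃ k₀ k₁ : ℤ, (k₀ = 1 ∨ k₀ = -1) ∧ (k₁ = 1 ∨ k₁ = -1) ∧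
      HasTurning Γ₁ q (k₁ * Real.pi) ∧ k₀ - k₁ = Z.card * d * 2 := by
    obtain ⟨k₀, hk₀, ht₀⟩ : ∃ k : ℤ, (k = 1 ∨ k = -1) ∧ HasTurning Γ₀ q (k * Real.pi) := by
      rcases h.line₀.hasTurning_or hq₀ with h1 | h1
      · exact ⟨1, Or.inl rfl, by simpa using h1⟩
      · exact ⟨-1, Or.inr rfl, by simpa using h1⟩
    obtain ⟨k₁, hk₁, ht₁⟩ : ∃ k : ℤ, (k = 1 ∨ k = -1) ∧ HasTurning Γ₁ q (k * Real.pi) := by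
      rcases h.line₁.hasTurning_or hq₁ with h1 | h1
      · exact ⟨1, Or.inl rfl, by simpa using h1⟩
      · exact ⟨-1, Or.inr rfl, by simpa using h1⟩
    refine ⟨k₀, k₁, hk₀, hk₁, ht₁, ?_⟩
    have h1 := h.turning_sub_turning ht₀ ht₁ hW
    have h2 : ((k₀ - k₁ : ℤ) : ℝ) * Real.pi = ((Z.card * d * 2 : ℤ) : ℝ) * Real.pi := by
      push_cast at h1 ⊢; linarith
    exact_mod_cast mul_right_cancel₀ hpi.ne' h2
  obtain ⟨k₀, k₁, hk₀, hk₁, ht₁, hk⟩ := key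
  have hpos : 1 ≤ Z.card := Finset.card_pos.2 ⟨x, hxZ⟩
  have hcard : Z.card = 1 := by
    have h1 : (Z.card : ℤ) * |d| = |(Z.card : ℤ) * d| := by rw [abs_mul, Nat.abs_cast]
    have h2 : 1 ≤ |d| := Int.one_le_abs hd0
    have h3 : |(Z.card : ℤ) * d| ≤ 1 := by
      rw [abs_le]; constructor <;> rcases hk₀ with rfl | rfl <;> rcases hk₁ with rfl | rfl <;> omega
    have h4 : (Z.card : ℤ) ≤ 1 := by nlinarith
    omega
  refine ⟨?_, fun y hy hyq => ?_⟩
  · have : k₁ = -d := by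
      rw [hcard] at hk
      push_cast at hk
      rcases hk₀ with rfl | rfl <;> rcases hk₁ with rfl | rfl <;> omega
    rw [this] at ht₁
    simpa using ht₁
  · exact Finset.card_le_one.1 hcard.le x hxZ y ((hZ y).2 ⟨hy, hyq⟩)

/-- Nearby interior points have open sets of values, and the complement of the two lines is dense.
-/
theorem exists_generic (h : BoundaryLines F Γ₀ Γ₁ a b) (hF : Continuous F) (hε : 0 < ε)
    (hinj : ∀ x ∈ closedBall (0 : ℂ) 1, ∀ y ∈ closedBall (0 : ℂ) 1, x ≠ y → dist x y < ε →
      F x ≠ F y) {x : ℂ} (hx : x ∈ closedBall (0 : ℂ) 1) {η : ℝ} (hη : 0 < η) {V : Set ℂ}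
    (hV : V ∈ 𝓝 (F x)) :
    ∃ x' ∈ ball (0 : ℂ) 1, x' ∈ ball x η ∧ F x' ∈ V ∧ F x' ∉ range Γ₀ ∧ F x' ∉ range Γ₁ := by
  rw [← closure_ball (0 : ℂ) one_ne_zero] at hx
  have hU : ball x η ∩ F ⁻¹' interior V ∈ 𝓝 x := inter_mem (ball_mem_nhds x hη)
    (hF.continuousAt.preimage_mem_nhds (interior_mem_nhds.2 hV))
  have hUo : IsOpen (ball x η ∩ F ⁻¹' interior V) :=
    isOpen_ball.inter (isOpen_interior.preimage hF)
  obtain ⟨w, hwU, hw⟩ := mem_closure_iff_nhds.1 hx _ hU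
  have h1 := image_mem_nhds_of_mem_ball hF hε hinj hw
    (inter_mem (hUo.mem_nhds hwU) (isOpen_ball.mem_nhds hw))
  have hdense : Dense ((range Γ₀)ᶜ ∩ (range Γ₁)ᶜ) :=
    h.line₀.dense_compl_range.inter_of_isOpen_left h.line₁.dense_compl_range
      h.line₀.isClosed_range.isOpen_compl
  obtain ⟨_, ⟨hq0, hq1⟩, x', ⟨⟨hx1, hx2⟩, hx3⟩, rfl⟩ := hdense.inter_nhds_nonempty h1
  exact ⟨x', hx3, hx1, interior_subset hx2, hq0, hq1⟩

theorem apply_ne_of_mem_ball (h : BoundaryLines F Γ₀ Γ₁ a b) (hF : Continuous F) (hε : 0 < ε)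
    (hinj : ∀ x ∈ closedBall (0 : ℂ) 1, ∀ y ∈ closedBall (0 : ℂ) 1, x ≠ y → dist x y < ε →
      F x ≠ F y) {x y : ℂ} (hx : x ∈ closedBall (0 : ℂ) 1) (hy : y ∈ ball (0 : ℂ) 1)
    (hxy : x ≠ y) : F x ≠ F y := by
  intro heq
  obtain ⟨τ, hτ⟩ := h.exists_turning hF hε hinj
  have hη : 0 < dist x y / 2 := by have := dist_pos.2 hxy; positivity
  have hV := image_mem_nhds_of_mem_ball hF hε hinj hy
    (inter_mem (ball_mem_nhds y hη) (isOpen_ball.mem_nhds hy))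
  rw [← heq] at hV
  obtain ⟨x', hx'D, hx', ⟨y', ⟨hy', hy'D⟩, hyx⟩, hq₀, hq₁⟩ :=
    h.exists_generic hF hε hinj hx hη hV
  have := (hτ _ hq₀ hq₁ x' (ball_subset_closedBall hx'D) rfl).2 y'
    (ball_subset_closedBall hy'D) hyx
  rw [this] at hx'
  have h1 := dist_triangle_left x y y'
  rw [mem_ball] at hx' hy'
  linarith

theorem apply_ne_of_mem_sphere (h : BoundaryLines F Γ₀ Γ₁ a b) (hF : Continuous F) (hε : 0 < ε)
    (hinj : ∀ x ∈ closedBall (0 : ℂ) 1, ∀ y ∈ closedBall (0 : ℂ) 1, x ≠ y → dist x y < ε →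
      F x ≠ F y) {x y : ℂ} (hx : x ∈ closedBall (0 : ℂ) 1) (hy : y ∈ sphere (0 : ℂ) 1)
    (hy₀ : y ∉ circleMap 0 1 '' Icc a b) (hxy : x ≠ y) : F x ≠ F y := by
  intro heq
  have hyD := sphere_subset_closedBall hy
  obtain ⟨τ, hτ⟩ := h.exists_turning hF hε hinj
  have hK₀ : IsCompact (circleMap 0 1 '' Icc a b) :=
    isCompact_Icc.image (continuous_circleMap 0 1)
  obtain ⟨η₀, hη₀, hη₀K⟩ := Metric.isOpen_iff.1 hK₀.isClosed.isOpen_compl y hy₀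
  obtain ⟨η, hη, hηε, hηxy, hηK⟩ : ∃ η > 0, η < ε ∧ 2 * η ≤ dist x y ∧ η ≤ η₀ :=
    ⟨min (ε / 2) (min (dist x y / 2) η₀), by have := dist_pos.2 hxy; positivity,
      (min_le_left _ _).trans_lt (by linarith),
      by linarith [(min_le_right (ε / 2) _).trans (min_le_left (dist x y / 2) η₀)],
      (min_le_right _ _).trans (min_le_right _ _)⟩
  have hcap : IsCompact (F '' (closedBall (0 : ℂ) 1 ∩ sphere y η)) :=
    ((isCompact_closedBall 0 1).inter_right isClosed_sphere).image hF
  have hFy : F y ∈ (F '' (closedBall (0 : ℂ) 1 ∩ sphere y η))ᶜ := by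
    rintro ⟨u, ⟨huD, hu⟩, huy⟩
    rw [mem_sphere] at hu
    exact hinj u huD y hyD (dist_pos.1 (hu ▸ hη)) (hu ▸ hηε) huy
  obtain ⟨R₀, hR₀, hR₀c⟩ := Metric.isOpen_iff.1 hcap.isClosed.isOpen_compl _ hFy
  obtain ⟨t, ht, rfl⟩ := (mem_arcs_of_mem_sphere a b hy).resolve_left hy₀
  obtain ⟨R, hR, hRR, C, C', hC, hC', -, -, hCΓ, hCΓ', hCR, hCR', hcov, hCσ, hCσ'⟩ :=
    h.line₁.exists_sides (-t) hR₀
  rw [h.arc₁ t ht] at hCR hCR' hcov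
  set y := circleMap 0 1 t
  have hV : IsOpen (F '' (ball (0 : ℂ) 1 ∩ ball y η)) := by
    rw [isOpen_iff_mem_nhds]
    rintro _ ⟨u, hu, rfl⟩
    exact image_mem_nhds_of_mem_ball hF hε hinj hu.1 ((isOpen_ball.inter isOpen_ball).mem_nhds hu)
  -- A limit value is `F u` with `u` in the closed cap. The outer circle is excluded by `R₀`, and a
  -- boundary point of the cap would lie on the second arc, hence map into `Γ₁`. So `u` is in the
  -- open cap, whose image is both open and closed relative to each side.
  have hclosure : closure (F '' (ball (0 : ℂ) 1 ∩ ball y η)) ∩ (ball (F y) R \ range Γ₁) ⊆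
      F '' (ball (0 : ℂ) 1 ∩ ball y η) := by
    rintro q ⟨hq, hqR, hqΓ⟩
    have h1 : IsClosed (F '' (closedBall (0 : ℂ) 1 ∩ closedBall y η)) :=
      (((isCompact_closedBall 0 1).inter_right isClosed_closedBall).image hF).isClosed
    obtain ⟨u, ⟨hu1, hu2⟩, rfl⟩ := closure_minimal
      (image_mono (inter_subset_inter ball_subset_closedBall ball_subset_closedBall)) h1 hq
    rcases eq_or_lt_of_le (mem_closedBall.1 hu2) with h2 | h2
    · exact absurd ⟨u, ⟨hu1, h2⟩, rfl⟩ (hR₀c (ball_subset_ball hRR hqR))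
    · refine ⟨u, ⟨mem_ball.2 (lt_of_le_of_ne hu1 fun h3 => hqΓ (h.apply_mem_range₁ ?_)), h2⟩, rfl⟩
      exact (mem_arcs_of_mem_sphere a b h3).resolve_left
        (hη₀K (ball_subset_ball hηK h2))
  have hfill : ∀ {C : Set ℂ}, IsPreconnected C → Disjoint C (range Γ₁) → C ⊆ ball (F y) R →
      ∀ q ∈ C, q ∈ F '' (ball (0 : ℂ) 1 ∩ ball y η) →
        C ⊆ F '' (ball (0 : ℂ) 1 ∩ ball y η) := fun hC hCΓ hCR q hq hqV =>
    hC.subset_of_closure_inter_subset hV ⟨q, hq, hqV⟩ fun w hw =>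
      hclosure ⟨hw.1, hCR hw.2, disjoint_left.1 hCΓ hw.2⟩
  obtain ⟨y', hy'D, hy', hyR, hy₀', hy₁'⟩ :=
    h.exists_generic hF hε hinj hyD hη (ball_mem_nhds (F y) hR)
  obtain ⟨x', hx'D, hx', hxR, hx₀', hx₁'⟩ :=
    h.exists_generic hF hε hinj hx hη (V := ball (F y) R) (heq ▸ ball_mem_nhds (F y) hR)
  obtain ⟨hyτ, -⟩ := hτ _ hy₀' hy₁' y' (ball_subset_closedBall hy'D) rfl
  obtain ⟨hxτ, huniq⟩ := hτ _ hx₀' hx₁' x' (ball_subset_closedBall hx'D) rfl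
  have hπ : Real.pi ≠ -Real.pi := by linarith [Real.pi_pos]
  -- Both values have turning `τ` while the two sides have opposite turnings, so the values share a
  -- side, and the cap at `y` fills it.
  have hmem : F x' ∈ F '' (ball (0 : ℂ) 1 ∩ ball y η) := by
    rcases hcov ⟨hyR, hy₁'⟩ with hyC | hyC <;> rcases hcov ⟨hxR, hx₁'⟩ with hxC | hxC
    · exact hfill hC hCΓ hCR _ hyC ⟨y', ⟨hy'D, hy'⟩, rfl⟩ hxC
    · exact absurd ((hCσ _ hyC).unique hyτ |>.trans (hxτ.unique (hCσ' _ hxC))) hπ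
    · exact absurd ((hCσ _ hxC).unique hxτ |>.trans (hyτ.unique (hCσ' _ hyC))) hπ
    · exact hfill hC' hCΓ' hCR' _ hyC ⟨y', ⟨hy'D, hy'⟩, rfl⟩ hxC
  obtain ⟨y'', ⟨hy''D, hy''⟩, hyx⟩ := hmem
  have := huniq y'' (ball_subset_closedBall hy''D) hyx
  rw [this] at hx'
  have h1 := dist_triangle_left x y y''
  rw [mem_ball] at hx' hy''
  linarith

theorem injOn_closedBall (h : BoundaryLines F Γ₀ Γ₁ a b) (hF : Continuous F) (hε : 0 < ε)
    (hinj : ∀ x ∈ closedBall (0 : ℂ) 1, ∀ y ∈ closedBall (0 : ℂ) 1, x ≠ y → dist x y < ε →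
      F x ≠ F y) : InjOn F (closedBall (0 : ℂ) 1) := by
  intro x hx y hy heq
  by_contra hxy
  rcases eq_or_lt_of_le (mem_closedBall.1 hy) with hys | hyb
  · rcases eq_or_lt_of_le (mem_closedBall.1 hx) with hxs | hxb
    · by_cases hy₀ : y ∈ circleMap 0 1 '' Icc a b
      · by_cases hx₀ : x ∈ circleMap 0 1 '' Icc a b
        · exact hxy (h.injOn₀ hx₀ hy₀ heq)
        · exact h.apply_ne_of_mem_sphere hF hε hinj hy hxs hx₀ (Ne.symm hxy) heq.symm
      · exact h.apply_ne_of_mem_sphere hF hε hinj hx hys hy₀ hxy heq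
    · exact h.apply_ne_of_mem_ball hF hε hinj hy hxb (Ne.symm hxy) heq.symm
  · exact h.apply_ne_of_mem_ball hF hε hinj hx hyb hxy heq

end BoundaryLines

end Disk

/-! ### Lines made from polygonal arcs and rays. -/

section Polygon

open Filter Topology Metric

/-- The curve `g` on `[c, d]`, with horizontal rays attached to its end points: one to the left of
`g c` and one to the right of `g d`. -/
noncomputable def extendByRays (g : ℝ → ℂ) (c d t : ℝ) : ℂ :=
  g (max c (min t d)) + ((min (t - c) 0 + max (t - d) 0 : ℝ) : ℂ)

variable {g : ℝ → ℂ} {c d : ℝ}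

theorem extendByRays_of_le (hcd : c ≤ d) {t : ℝ} (ht : t ≤ c) :
    extendByRays g c d t = g c + (t - c : ℝ) := by
  rw [extendByRays, min_eq_left (ht.trans hcd), max_eq_left ht, min_eq_left (by linarith),
    max_eq_right (by linarith), add_zero]

theorem extendByRays_of_ge (hcd : c ≤ d) {t : ℝ} (ht : d ≤ t) :
    extendByRays g c d t = g d + (t - d : ℝ) := by
  rw [extendByRays, min_eq_right ht, max_eq_right hcd, min_eq_right (by linarith),
    max_eq_left (by linarith), zero_add]

theorem extendByRays_of_mem {t : ℝ} (ht : t ∈ Icc c d) : extendByRays g c d t = g t := by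
  rw [extendByRays, min_eq_left ht.2, max_eq_right ht.1, min_eq_right (by linarith [ht.1]),
    max_eq_right (by linarith [ht.2])]
  simp

theorem rightwardLine_extendByRays (hg : Continuous g) (hcd : c ≤ d)
    (hinj : Function.Injective (extendByRays g c d))
    (hright : ∀ s, ∃ ε > 0, ∃ e : ℂ, ∀ t ∈ Icc s (s + ε), ∃ r : ℝ, 0 ≤ r ∧ g t = g s + r * e)
    (hleft : ∀ s, ∃ ε > 0, ∃ e : ℂ, ∀ t ∈ Icc (s - ε) s, ∃ r : ℝ, 0 ≤ r ∧ g t = g s + r * e) :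
    RightwardLine (extendByRays g c d) where
  continuous := by unfold extendByRays; fun_prop
  injective := hinj
  right_ray := ⟨d, g d - d, fun t ht => by
    rw [extendByRays_of_ge hcd ht]; push_cast; ring⟩
  left_ray := ⟨c, g c - c, fun t ht => by
    rw [extendByRays_of_le hcd ht]; push_cast; ring⟩
  cone_right := fun s => by
    rcases lt_or_ge s c with hs | hs
    · refine ⟨c - s, by linarith, 1, fun t ht => ⟨t - s, by linarith [ht.1], ?_⟩⟩
      rw [extendByRays_of_le hcd hs.le, extendByRays_of_le hcd (by linarith [ht.2])]
      push_cast; ring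
    · rcases lt_or_ge s d with hsd | hsd
      · obtain ⟨ε, hε, e, he⟩ := hright s
        refine ⟨min ε (d - s), lt_min hε (by linarith), e, fun t ht => ?_⟩
        have h1 := min_le_left ε (d - s)
        have h2 := min_le_right ε (d - s)
        rw [extendByRays_of_mem ⟨hs, hsd.le⟩,
          extendByRays_of_mem ⟨hs.trans ht.1, by linarith [ht.2]⟩]
        exact he t ⟨ht.1, by linarith [ht.2]⟩
      · refine ⟨1, one_pos, 1, fun t ht => ⟨t - s, by linarith [ht.1], ?_⟩⟩
        rw [extendByRays_of_ge hcd hsd, extendByRays_of_ge hcd (hsd.trans ht.1)]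
        push_cast; ring
  cone_left := fun s => by
    rcases le_or_gt s c with hs | hs
    · refine ⟨1, one_pos, -1, fun t ht => ⟨s - t, by linarith [ht.2], ?_⟩⟩
      rw [extendByRays_of_le hcd hs, extendByRays_of_le hcd (ht.2.trans hs)]
      push_cast; ring
    · rcases le_or_gt s d with hsd | hsd
      · obtain ⟨ε, hε, e, he⟩ := hleft s
        refine ⟨min ε (s - c), lt_min hε (by linarith), e, fun t ht => ?_⟩
        have h1 := min_le_left ε (s - c)
        have h2 := min_le_right ε (s - c)
        rw [extendByRays_of_mem ⟨hs.le, hsd⟩,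
          extendByRays_of_mem ⟨by linarith [ht.1], ht.2.trans hsd⟩]
        exact he t ⟨by linarith [ht.1], ht.2⟩
      · refine ⟨s - d, by linarith, -1, fun t ht => ⟨s - t, by linarith [ht.2], ?_⟩⟩
        rw [extendByRays_of_ge hcd hsd.le, extendByRays_of_ge hcd (by linarith [ht.1])]
        push_cast; ring

/-- The affine coordinate along the segment is continuous and injective in time, hence strictly
monotone; the sense of monotonicity decides the sign of `e`. -/
theorem exists_direction_of_mem_segment (hg : Continuous g) {s ε : ℝ} (hε : 0 ≤ ε) {P Q : ℂ}
    (hinj : InjOn g (Icc s (s + ε))) (hseg : ∀ t ∈ Icc s (s + ε), g t ∈ segment ℝ P Q) :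
    ∃ e : ℂ, ∀ t ∈ Icc s (s + ε), ∃ r : ℝ, 0 ≤ r ∧ g t = g s + r * e := by
  have hs : s ∈ Icc s (s + ε) := ⟨le_rfl, by linarith⟩
  have hform : ∀ t ∈ Icc s (s + ε), ∃ x : ℝ, g t = P + x * (Q - P) := fun t ht => by
    obtain ⟨u, v, -, -, huv, h1⟩ := hseg t ht
    refine ⟨v, ?_⟩
    rw [← h1]
    obtain rfl : u = 1 - v := by linarith
    simp only [Complex.real_smul]; push_cast; ring
  by_cases hPQ : Q - P = 0
  · refine ⟨0, fun t ht => ⟨0, le_rfl, ?_⟩⟩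
    obtain ⟨x, hx⟩ := hform t ht
    obtain ⟨y, hy⟩ := hform s hs
    rw [hx, hy, hPQ]; simp
  have hx : ∀ t ∈ Icc s (s + ε), g t = P + (((g t - P) / (Q - P)).re : ℂ) * (Q - P) :=
    fun t ht => by
      obtain ⟨x, h1⟩ := hform t ht
      have h2 : (g t - P) / (Q - P) = x := by rw [h1]; field_simp; ring
      rw [h2, Complex.ofReal_re]; exact h1
  have hxi : InjOn (fun t => ((g t - P) / (Q - P)).re) (Icc s (s + ε)) := by
    intro t ht t' ht' h1
    refine hinj ht ht' ?_
    simp only at h1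
    rw [hx t ht, h1, ← hx t' ht']
  have hxc : Continuous fun t => ((g t - P) / (Q - P)).re :=
    Complex.continuous_re.comp ((hg.sub continuous_const).div_const _)
  rcases hxc.continuousOn.strictMonoOn_of_injOn_Icc' (by linarith) hxi with hm | hm
  · refine ⟨Q - P, fun t ht => ⟨((g t - P) / (Q - P)).re - ((g s - P) / (Q - P)).re,
      sub_nonneg.2 (hm.monotoneOn hs ht ht.1), ?_⟩⟩
    push_cast
    linear_combination hx t ht - hx s hs
  · refine ⟨-(Q - P), fun t ht => ⟨((g s - P) / (Q - P)).re - ((g t - P) / (Q - P)).re,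
      sub_nonneg.2 (hm.antitoneOn hs ht ht.1), ?_⟩⟩
    push_cast
    linear_combination hx t ht - hx s hs

theorem exists_direction_of_mem_segment_left (hg : Continuous g) {s ε : ℝ} (hε : 0 ≤ ε) {P Q : ℂ}
    (hinj : InjOn g (Icc (s - ε) s)) (hseg : ∀ t ∈ Icc (s - ε) s, g t ∈ segment ℝ P Q) :
    ∃ e : ℂ, ∀ t ∈ Icc (s - ε) s, ∃ r : ℝ, 0 ≤ r ∧ g t = g s + r * e := by
  have hmaps : ∀ t ∈ Icc (-s) (-s + ε), -t ∈ Icc (s - ε) s := fun t ht =>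
    ⟨by linarith [ht.2], by linarith [ht.1]⟩
  obtain ⟨e, he⟩ := exists_direction_of_mem_segment (g := fun t => g (-t)) (s := -s)
    (by fun_prop) hε
    (fun t ht t' ht' h1 => neg_injective (hinj (hmaps t ht) (hmaps t' ht') h1))
    (fun t ht => hseg _ (hmaps t ht))
  refine ⟨e, fun t ht => ?_⟩
  simpa using he (-t) ⟨by linarith [ht.2], by linarith [ht.1]⟩

theorem Fin.exists_castSucc_succ {k : ℕ} {p : Fin (k + 1) → Prop} (h0 : ¬p 0)
    (hl : p (Fin.last k)) : ∃ i : Fin k, ¬p i.castSucc ∧ p i.succ := by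
  by_contra hcon
  have : ∀ i, ¬p i := by
    intro i
    induction i using Fin.induction with
    | zero => exact h0
    | succ i ih => exact fun h => hcon ⟨i, ih, h⟩
  exact this _ hl

end Polygon

/-! ### Passage from the Euclidean plane and its disk to `ℂ`. -/

section Transport

open Filter Topology Metric

/-- The identification of the plane with `ℂ` which makes the real part the height. -/
noncomputable def planeToComplex : Plane →ₗ[ℝ] ℂ where
  toFun x := ⟨x 1, x 0⟩
  map_add' x y := by apply Complex.ext <;> simp
  map_smul' r x := by apply Complex.ext <;> simp

theorem planeToComplex_injective : Function.Injective planeToComplex := by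
  intro x y hxy
  have h1 := congrArg Complex.re hxy
  have h2 := congrArg Complex.im hxy
  simp only [planeToComplex, LinearMap.coe_mk, AddHom.coe_mk] at h1 h2
  ext i
  fin_cases i
  · exact h2
  · exact h1

theorem continuous_planeToComplex : Continuous planeToComplex :=
  planeToComplex.continuous_of_finiteDimensional

theorem planeToComplex_add_smul_up (x : Plane) (r : ℝ) :
    planeToComplex (x + r • !₂[(0 : ℝ), 1]) = planeToComplex x + r := by
  rw [map_add, map_smul]
  congr 1
  apply Complex.ext <;> simp [planeToComplex]

/-- The radial retraction of `ℂ` onto the closed unit disk. -/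
noncomputable def diskRetract (z : ℂ) : ClosedDisk :=
  ⟨Complex.orthonormalBasisOneI.repr (((max 1 ‖z‖)⁻¹ : ℝ) * z), by
    rw [mem_closedBall, dist_zero_right, LinearIsometryEquiv.norm_map, norm_mul,
      Complex.norm_real, norm_inv, Real.norm_of_nonneg (by positivity)]
    rw [inv_mul_le_one₀ (by positivity)]
    exact le_max_right _ _⟩

theorem continuous_diskRetract : Continuous diskRetract := by
  refine Continuous.subtype_mk (Complex.orthonormalBasisOneI.repr.continuous.comp ?_) _
  refine (Complex.continuous_ofReal.comp (Continuous.inv₀ (by fun_prop) fun z => ?_)).mul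
    continuous_id
  positivity

theorem coe_diskRetract {z : ℂ} (hz : z ∈ closedBall (0 : ℂ) 1) :
    (diskRetract z : Plane) = Complex.orthonormalBasisOneI.repr z := by
  rw [mem_closedBall, dist_zero_right] at hz
  simp [diskRetract, max_eq_left hz]

theorem dist_diskRetract {z w : ℂ} (hz : z ∈ closedBall (0 : ℂ) 1)
    (hw : w ∈ closedBall (0 : ℂ) 1) : dist (diskRetract z) (diskRetract w) = dist z w := by
  rw [Subtype.dist_eq, coe_diskRetract hz, coe_diskRetract hw, LinearIsometryEquiv.dist_map]

theorem diskRetract_circleMap (t : ℝ) : diskRetract (circleMap 0 1 t) = circlePoint t := by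
  apply Subtype.ext
  rw [coe_diskRetract (circleMap_mem_closedBall 0 zero_le_one t)]
  ext i
  fin_cases i <;> simp [circlePoint, circleMap, Complex.exp_ofReal_mul_I_re,
    Complex.exp_ofReal_mul_I_im]

theorem exists_diskRetract_eq (u : ClosedDisk) :
    ∃ z ∈ closedBall (0 : ℂ) 1, diskRetract z = u := by
  have hu := u.2
  rw [mem_closedBall, dist_zero_right] at hu
  have hz : Complex.orthonormalBasisOneI.repr.symm u ∈ closedBall (0 : ℂ) 1 := by
    rwa [mem_closedBall, dist_zero_right, LinearIsometryEquiv.norm_map]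
  exact ⟨_, hz, Subtype.ext (by rw [coe_diskRetract hz, LinearIsometryEquiv.apply_symm_apply])⟩

theorem circlePoint_add_int_mul (t : ℝ) (n : ℤ) :
    circlePoint (t + n * (2 * Real.pi)) = circlePoint t := by
  apply Subtype.ext
  simp [circlePoint, Real.cos_add_int_mul_two_pi, Real.sin_add_int_mul_two_pi]

theorem circlePoint_add_two_pi (t : ℝ) : circlePoint (t + 2 * Real.pi) = circlePoint t := by
  simpa using circlePoint_add_int_mul t 1

theorem exists_int_of_circlePoint_eq {s t : ℝ} (h : circlePoint s = circlePoint t) :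
    ∃ n : ℤ, s = t + n * (2 * Real.pi) := by
  have h1 := congrArg (fun u : ClosedDisk => (u : Plane) 0) h
  have h2 := congrArg (fun u : ClosedDisk => (u : Plane) 1) h
  simp only [circlePoint] at h1 h2
  have h3 := (Real.Angle.angle_eq_iff_two_pi_dvd_sub (ψ := s) (θ := t)).1
    (Real.Angle.cos_sin_inj (by simpa using h1.symm) (by simpa using h2.symm))
  obtain ⟨n, hn⟩ := h3
  exact ⟨-n, by push_cast; linarith⟩

theorem IsLocallyInjective.exists_uniform {f : ClosedDisk → Plane} (hf : IsLocallyInjective f) :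
    ∃ ε > 0, ∀ u v : ClosedDisk, u ≠ v → dist u v < ε → f u ≠ f v := by
  choose U hUo hxU hUinj using hf
  have : CompactSpace ClosedDisk := isCompact_iff_compactSpace.1 (isCompact_closedBall 0 1)
  obtain ⟨ε, hε, hcov⟩ := lebesgue_number_lemma_of_metric (isCompact_univ (X := ClosedDisk)) hUo
    (fun x _ => mem_iUnion.2 ⟨x, hxU x⟩)
  refine ⟨ε, hε, fun u v huv hd heq => huv ?_⟩
  obtain ⟨i, hi⟩ := hcov v (mem_univ v)
  exact hUinj i (hi hd) (hi (mem_ball_self hε)) heq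

end Transport

/-! ### Construction of the boundary lines of a polygonal immersion. -/

section PolygonalDisk

open Filter Topology Metric

theorem planeToComplex_verticalExtension {γ : ℝ → Plane} {a b : ℝ} (hab : a ≤ b)
    (h : planeHeight (γ a) < planeHeight (γ b)) (t : ℝ) :
    planeToComplex (verticalExtension γ a b t) =
      extendByRays (fun t => planeToComplex (γ t)) a b t := by
  simp only [verticalExtension, if_pos h, one_mul]
  split_ifs with h1 h2
  · rw [planeToComplex_add_smul_up, extendByRays_of_le hab h1.le]
  · rw [extendByRays_of_mem ⟨not_lt.1 h1, h2⟩]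
  · rw [planeToComplex_add_smul_up, extendByRays_of_ge hab (not_le.1 h2).le]

/-- A descending arc, with its rays, becomes a rightward line when traversed backwards; this
provides `Γ₁`. -/
theorem planeToComplex_verticalExtension_neg {γ : ℝ → Plane} {a b : ℝ} (hab : a ≤ b)
    (h : planeHeight (γ b) < planeHeight (γ a)) (t : ℝ) :
    planeToComplex (verticalExtension γ a b (-t)) =
      extendByRays (fun t => planeToComplex (γ (-t))) (-b) (-a) t := by
  simp only [verticalExtension, if_neg (not_lt.2 h.le)]
  split_ifs with h1 h2
  · rw [planeToComplex_add_smul_up, extendByRays_of_ge (neg_le_neg hab) (by linarith), neg_neg]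
    congr 2; ring
  · rw [extendByRays_of_mem ⟨by linarith, by linarith⟩]
  · rw [planeToComplex_add_smul_up, extendByRays_of_le (neg_le_neg hab) (by linarith), neg_neg]
    congr 2; ring

theorem IsWeaklyMonotone.add_int_mul {f : ClosedDisk → Plane} {a b : ℝ}
    (h : IsWeaklyMonotone (fun t => f (circlePoint t)) a b) (n : ℤ) :
    IsWeaklyMonotone (fun t => f (circlePoint t)) (a + n * (2 * Real.pi))
      (b + n * (2 * Real.pi)) where
  le := by linarith [h.le]
  continuousOn := by
    have h1 := h.continuousOn.comp (f := fun t => t - n * (2 * Real.pi))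
      (s := Icc (a + n * (2 * Real.pi)) (b + n * (2 * Real.pi))) (by fun_prop)
      (fun t ht => ⟨by linarith [ht.1], by linarith [ht.2]⟩)
    refine h1.congr fun t _ => ?_
    simp only [Function.comp]
    rw [← circlePoint_add_int_mul (t - n * (2 * Real.pi)) n, sub_add_cancel]
  injOn := by
    intro s hs t ht hst
    have h1 := h.injOn (x₁ := s - n * (2 * Real.pi)) (x₂ := t - n * (2 * Real.pi))
      ⟨by linarith [hs.1], by linarith [hs.2]⟩ ⟨by linarith [ht.1], by linarith [ht.2]⟩ (by
        rw [← circlePoint_add_int_mul (s - n * (2 * Real.pi)) n,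
          ← circlePoint_add_int_mul (t - n * (2 * Real.pi)) n, sub_add_cancel, sub_add_cancel]
        exact hst)
    linarith
  height_ne := by
    simp only [circlePoint_add_int_mul]; exact h.height_ne
  injective_extension := by
    have h1 : ∀ t, verticalExtension (fun t => f (circlePoint t)) (a + n * (2 * Real.pi))
        (b + n * (2 * Real.pi)) t =
          verticalExtension (fun t => f (circlePoint t)) a b (t - n * (2 * Real.pi)) := by
      intro t
      simp only [verticalExtension, circlePoint_add_int_mul, sub_lt_iff_lt_add, sub_le_iff_le_add,
        sub_sub, add_comm (n * (2 * Real.pi))]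
      rw [← circlePoint_add_int_mul (t - n * (2 * Real.pi)) n, sub_add_cancel]
    intro s t hst
    rw [h1, h1] at hst
    linarith [h.injective_extension hst]

/-- The part of a polygonal curve before and after a point lies in segments. -/
theorem HasPolygonalBoundary.exists_segments {f : ClosedDisk → Plane}
    (hf : HasPolygonalBoundary f) (s : ℝ) :
    (∃ ε > 0, ∃ P Q : ℂ, ∀ t ∈ Icc s (s + ε), planeToComplex (f (circlePoint t)) ∈
      segment ℝ P Q) ∧
    ∃ ε > 0, ∃ P Q : ℂ, ∀ t ∈ Icc (s - ε) s, planeToComplex (f (circlePoint t)) ∈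
      segment ℝ P Q := by
  obtain ⟨k, θ, hθ, hlast, hseg⟩ := hf
  have hmem : ∀ i : Fin k, ∀ n : ℤ, ∀ t, t - n * (2 * Real.pi) ∈ Icc (θ i.castSucc) (θ i.succ) →
      planeToComplex (f (circlePoint t)) ∈
        segment ℝ (planeToComplex (f (circlePoint (θ i.castSucc))))
          (planeToComplex (f (circlePoint (θ i.succ)))) := fun i n t ht => by
    have h1 : f (circlePoint t) ∈ segment ℝ (f (circlePoint (θ i.castSucc)))
        (f (circlePoint (θ i.succ))) := by
      rw [← hseg i]
      exact ⟨_, ht, by simp only; rw [← circlePoint_add_int_mul _ n, sub_add_cancel]⟩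
    obtain ⟨u, v, hu, hv, huv, h2⟩ := h1
    exact ⟨u, v, hu, hv, huv, by rw [← h2, map_add, map_smul, map_smul]⟩
  constructor
  · obtain ⟨n, hn, -⟩ := existsUnique_sub_zsmul_mem_Ico Real.two_pi_pos s (θ 0)
    rw [← hlast, zsmul_eq_mul] at hn
    obtain ⟨i, hi1, hi2⟩ := Fin.exists_castSucc_succ (p := fun i => s - n * (2 * Real.pi) < θ i)
      (not_lt.2 hn.1) hn.2
    refine ⟨θ i.succ - (s - n * (2 * Real.pi)), by linarith, _, _, fun t ht => hmem i n t ?_⟩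
    exact ⟨by linarith [ht.1], by linarith [ht.2]⟩
  · obtain ⟨n, hn, -⟩ := existsUnique_sub_zsmul_mem_Ioc Real.two_pi_pos s (θ 0)
    rw [← hlast, zsmul_eq_mul] at hn
    obtain ⟨i, hi1, hi2⟩ := Fin.exists_castSucc_succ (p := fun i => s - n * (2 * Real.pi) ≤ θ i)
      (not_le.2 hn.1) hn.2
    rw [not_le] at hi1
    refine ⟨s - n * (2 * Real.pi) - θ i.castSucc, by linarith, _, _, fun t ht => hmem i n t ?_⟩
    exact ⟨by linarith [ht.1], by linarith [ht.2]⟩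

theorem injective_of_isWeaklyMonotone {f : ClosedDisk → Plane} (hf : IsTopImmersion f)
    (hpoly : HasPolygonalBoundary f) {a b : ℝ}
    (h₀ : IsWeaklyMonotone (fun t => f (circlePoint t)) a b)
    (h₁ : IsWeaklyMonotone (fun t => f (circlePoint t)) b (a + 2 * Real.pi))
    (hlt : planeHeight (f (circlePoint a)) < planeHeight (f (circlePoint b))) :
    Function.Injective f := by
  obtain ⟨hfc, hfi⟩ := hf
  obtain ⟨ε, hε, hεinj⟩ := hfi.exists_uniform
  -- Retracting onto the disk makes `F` continuous on all of `ℂ`. `planeToComplex` reverses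
  -- orientation, which is harmless because the sign of the degree is never used.
  let F : ℂ → ℂ := fun z => planeToComplex (f (diskRetract z))
  let g : ℝ → ℂ := fun t => planeToComplex (f (circlePoint t))
  have hF : Continuous F := continuous_planeToComplex.comp (hfc.comp continuous_diskRetract)
  have hFg : ∀ t, F (circleMap 0 1 t) = g t := fun t => by simp only [F, g, diskRetract_circleMap]
  have hg : Continuous g := (hF.comp (continuous_circleMap 0 1)).congr hFg
  have hinj : ∀ x ∈ closedBall (0 : ℂ) 1, ∀ y ∈ closedBall (0 : ℂ) 1, x ≠ y → dist x y < ε →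
      F x ≠ F y := fun x hx y hy hxy hd heq => by
    rw [← dist_diskRetract hx hy] at hd
    refine hεinj _ _ ?_ hd (planeToComplex_injective heq)
    rwa [← dist_pos, dist_diskRetract hx hy, dist_pos]
  obtain ⟨η, hη, hηε, hηpi⟩ : ∃ η > 0, η < ε ∧ η < 2 * Real.pi := by
    have := Real.pi_pos
    exact ⟨min (ε / 2) Real.pi, by positivity, (min_le_left _ _).trans_lt (by linarith),
      (min_le_right _ _).trans_lt (by linarith)⟩
  -- Parameters less than a full turn apart give distinct points of the circle, and their chord is
  -- no longer than `|s - t|`, hence below the scale of injectivity.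
  have hginj : ∀ s t, |s - t| ≤ η → g s = g t → s = t := fun s t hst heq => by
    by_contra hne
    refine hinj (circleMap 0 1 s) (circleMap_mem_closedBall _ zero_le_one _) (circleMap 0 1 t)
      (circleMap_mem_closedBall _ zero_le_one _) (fun h => hne ?_) ?_ (by rw [hFg, hFg, heq])
    · refine eq_of_exp_mul_I_eq (hst.trans_lt hηpi) ?_
      simpa [circleMap] using h
    · have := (lipschitzWith_circleMap 0 1).dist_le_mul s t
      rw [Real.dist_eq] at this
      simp at this
      linarith
  have hright : ∀ s, ∃ ε > 0, ∃ e : ℂ, ∀ t ∈ Icc s (s + ε), ∃ r : ℝ, 0 ≤ r ∧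
      g t = g s + r * e := fun s => by
    obtain ⟨δ, hδ, P, Q, hPQ⟩ := (hpoly.exists_segments s).1
    have h1 := min_le_left δ η
    have h2 := min_le_right δ η
    refine ⟨min δ η, lt_min hδ hη, exists_direction_of_mem_segment hg (by positivity) ?_
      fun t ht => hPQ t ⟨ht.1, by linarith [ht.2]⟩⟩
    refine fun t ht t' ht' => hginj t t' (abs_le.2 ⟨?_, ?_⟩)
    · linarith [ht.1, ht'.2]
    · linarith [ht'.1, ht.2]
  have hleft : ∀ s, ∃ ε > 0, ∃ e : ℂ, ∀ t ∈ Icc (s - ε) s, ∃ r : ℝ, 0 ≤ r ∧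
      g t = g s + r * e := fun s => by
    obtain ⟨δ, hδ, P, Q, hPQ⟩ := (hpoly.exists_segments s).2
    have h1 := min_le_left δ η
    have h2 := min_le_right δ η
    refine ⟨min δ η, lt_min hδ hη, exists_direction_of_mem_segment_left hg (by positivity) ?_
      fun t ht => hPQ t ⟨by linarith [ht.1], ht.2⟩⟩
    refine fun t ht t' ht' => hginj t t' (abs_le.2 ⟨?_, ?_⟩)
    · linarith [ht.1, ht'.2]
    · linarith [ht'.1, ht.2]
  have hlt' : planeHeight (f (circlePoint (a + 2 * Real.pi))) < planeHeight (f (circlePoint b)) := by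
    rwa [circlePoint_add_two_pi]
  have hga : g (a + 2 * Real.pi) = g a := by simp only [g, circlePoint_add_two_pi]
  have hle := neg_le_neg h₁.le
  have hlines : BoundaryLines F (extendByRays g a b)
      (extendByRays (fun t => g (-t)) (-(a + 2 * Real.pi)) (-b)) a b := by
    refine ⟨rightwardLine_extendByRays hg h₀.le ?_ hright hleft,
      rightwardLine_extendByRays (hg.comp continuous_neg) hle ?_ (fun s => ?_) (fun s => ?_),
      h₀.le, h₁.le, fun t ht => ?_, fun t ht => ?_, fun τ hτ => ?_, fun τ hτ => ?_⟩
    · have h1 := planeToComplex_verticalExtension (γ := fun t => f (circlePoint t)) h₀.le hlt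
      exact fun s t hst => h₀.injective_extension
        (planeToComplex_injective (((h1 s).trans hst).trans (h1 t).symm))
    · have h1 := planeToComplex_verticalExtension_neg (γ := fun t => f (circlePoint t))
        h₁.le hlt'
      exact fun s t hst => neg_injective (h₁.injective_extension
        (planeToComplex_injective (((h1 s).trans hst).trans (h1 t).symm)))
    · obtain ⟨δ, hδ, e, he⟩ := hleft (-s)
      exact ⟨δ, hδ, e, fun t ht => he (-t) ⟨by linarith [ht.2], by linarith [ht.1]⟩⟩
    · obtain ⟨δ, hδ, e, he⟩ := hright (-s)
      exact ⟨δ, hδ, e, fun t ht => he (-t) ⟨by linarith [ht.2], by linarith [ht.1]⟩⟩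
    · rw [extendByRays_of_mem ht, hFg]
    · rw [extendByRays_of_mem ⟨neg_le_neg ht.2, neg_le_neg ht.1⟩, hFg, neg_neg]
    · rw [extendByRays_of_ge h₀.le (by linarith), extendByRays_of_ge hle (by linarith), neg_neg]
      congr 2; ring
    · rw [extendByRays_of_le h₀.le (by linarith), extendByRays_of_le hle (by linarith), neg_neg,
        hga]
      congr 2; ring
  have hinjOn := hlines.injOn_closedBall hF hε hinj
  intro u v huv
  obtain ⟨z, hz, rfl⟩ := exists_diskRetract_eq u
  obtain ⟨w, hw, rfl⟩ := exists_diskRetract_eq v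
  rw [hinjOn hz hw (congrArg planeToComplex huv)]

end PolygonalDisk

/-! ### Matching the angles of the two arcs. -/

theorem proposition5p1 (f : ClosedDisk → Plane) (hf : IsTopImmersion f)
    (hpoly : HasPolygonalBoundary f) (p₀ p₁ : ClosedDisk)
    (hp₀ : p₀ ∈ diskBoundary) (hp₁ : p₁ ∈ diskBoundary)
    (h₀₁ : IsWeaklyMonotoneArc f p₀ p₁) (h₁₀ : IsWeaklyMonotoneArc f p₁ p₀) :
    Function.Injective f := by
  obtain ⟨a, b, hab, hba, rfl, rfl, h₀⟩ := h₀₁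
  obtain ⟨b', a', hba', hab', hb', ha', h₁⟩ := h₁₀
  have hpi := Real.pi_pos
  obtain ⟨m, hm⟩ := exists_int_of_circlePoint_eq hb'.symm
  have h₁' := h₁.add_int_mul m
  rw [← hm] at h₁'
  have hcirc : circlePoint (a' + m * (2 * Real.pi)) = circlePoint a := by
    rw [circlePoint_add_int_mul, ha']
  obtain ⟨n, hn⟩ := exists_int_of_circlePoint_eq hcirc
  have hne : a ≠ b := fun h => h₀.height_ne (by rw [h])
  have hne' : b ≠ a' + m * (2 * Real.pi) := fun h => h₁'.height_ne (by rw [← h])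
  have hlt : a < b := lt_of_le_of_ne hab hne
  have hlt' : b < a' + m * (2 * Real.pi) := lt_of_le_of_ne h₁'.le hne'
  -- Each arc spans an angle strictly between `0` and `2π`, so together they span a multiple of `2π`
  -- strictly between `0` and `4π`.
  have hn1 : n = 1 := by
    have h1 : (0 : ℝ) < n := by
      by_contra h
      nlinarith [not_lt.1 h]
    have h2 : (n : ℝ) < 2 := by
      by_contra h
      nlinarith [not_lt.1 h]
    have h3 : 0 < n := by exact_mod_cast h1
    have h4 : n < 2 := by exact_mod_cast h2
    omega
  rw [hn, hn1, Int.cast_one, one_mul] at h₁'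
  rcases lt_or_gt_of_ne h₀.height_ne with h | h
  · exact injective_of_isWeaklyMonotone hf hpoly h₀ h₁' h
  -- If the arc from `a` descends, the arcs exchange roles: start at `b` and shift the first arc by
  -- one turn.
  · have h₀' := h₀.add_int_mul 1
    rw [Int.cast_one, one_mul] at h₀'
    exact injective_of_isWeaklyMonotone hf hpoly h₁' h₀' (by rwa [circlePoint_add_two_pi])
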